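/- Let $\mathcal U^2=(0,1)^2$. A *basic box* is the solution set in $\mathbb R^2$ of a finite system of inequalities $b\cdot x\le c$ or $b\cdot x>c$ in which each $b\in\mathbb R^2$ has exactly one nonzero coordinate. A *finite rooted binary tree-structured partition* of $\mathcal U^2$ into basic boxes is the collection of the boxes at the terminal nodes of a finite rooted binary tree whose nodes carry nonempty basic boxes, the root carrying $\mathcal U^2$ and the box of each nonterminal node being the disjoint union of the boxes of its two children. For such a partition $Q$, let $\|Q\|$ be the largest Euclidean diameter of a member of $Q$, and for $x\in\mathcal U^2$ let $B_Q(x)$ be the member of $Q$ that contains $x$. **Theorem 1.2.** There exist finite rooted binary tree-structured partitions $Q^{(N)}$ $(N=1,2,\dots)$ of $\mathcal U^2$ into basic boxes of positive Lebesgue measure, with $\|Q^{(N)}\|\to0$, together with, on some probability space, independent identically distributed pairs $(X,Y),(X_1,Y_1),(X_2,Y_2),\dots$ with values in $\mathbb R^2\times\mathbb R$, such that $X$ is uniformly distributed on $\mathcal U^2$, $E|Y|<\infty$, and the following holds. Let $h(x)=E(Y\mid X=x)$ be the regression function and, with $B=B_{Q^{(N)}}(x)$, put $$h_N(x)=\frac{E(Y\,1_B(X))}{P(X\in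 B)},\qquad \hat h_N(x)=\frac{\frac1N\sum_{n=1}^N Y_n1_B(X_n)}{\frac1N\sum_{n=1}^N 1_B(X_n)}\ \text{ if some } X_n\in B,\ 1\le n\le N,\qquad \hat h_N(x)=0\ \text{ otherwise.}$$ Then $$P\big(\hat h_N(X)-h_N(X)\to0\big)=1,\qquad P\big(h_N(X)-h(X)\to0\big)=0,$$ and consequently $P\big(\hat h_N(X)\to h(X)\big)=0$. -/

import Mathlib

open MeasureTheory ProbabilityTheory Filter Topology

/-- A half-space cut out by one linear inequality `b • x ≤ c` or `b • x > c` whose normal vector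
`b` has exactly one nonzero coordinate (the `i`-th one, equal to `β`). -/
def IsBasicHalfSpace {d : ℕ} (H : Set (EuclideanSpace ℝ (Fin d))) : Prop :=
  ∃ (i : Fin d) (β c : ℝ), β ≠ 0 ∧ (H = {x | β * x i ≤ c} ∨ H = {x | β * x i > c})

/-- A basic box (interval): the solution set of a finite system of such inequalities. -/
def IsBasicBox {d : ℕ} (B : Set (EuclideanSpace ℝ (Fin d))) : Prop :=
  ∃ S : Finset (Set (EuclideanSpace ℝ (Fin d))),
    (∀ H ∈ S, IsBasicHalfSpace H) ∧ B = {x | ∀ H ∈ S, x ∈ H}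

/-- The open unit cube of `ℝ^d`. -/
def unitCube (d : ℕ) : Set (EuclideanSpace ℝ (Fin d)) :=
  {x | ∀ i, 0 < x i ∧ x i < 1}

/-- `IsTreePartition B Q`: `Q` is a finite rooted binary tree-structured partition of `B` into
(nonempty) basic boxes. The derivation is the tree: each node carries a basic box, the root carries
`B`, the box of a nonterminal node is the disjoint union of the boxes of its two children, and `Q`
is the set of boxes at the terminal nodes. In particular every pruned subtree with the same root
gives a coarser partition into basic boxes. -/
inductive IsTreePartition {d : ℕ} :
    Set (EuclideanSpace ℝ (Fin d)) → Set (Set (EuclideanSpace ℝ (Fin d))) → Prop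
  | leaf {B : Set (EuclideanSpace ℝ (Fin d))} (hB : IsBasicBox B) (hne : B.Nonempty) :
      IsTreePartition B {B}
  | node {B B₁ B₂ : Set (EuclideanSpace ℝ (Fin d))}
      {Q₁ Q₂ : Set (Set (EuclideanSpace ℝ (Fin d)))}
      (hB : IsBasicBox B) (hunion : B₁ ∪ B₂ = B) (hdisj : Disjoint B₁ B₂)
      (h₁ : IsTreePartition B₁ Q₁) (h₂ : IsTreePartition B₂ Q₂) :
      IsTreePartition B (Q₁ ∪ Q₂)

/-- The member of the partition `Q` that contains `x` (empty if there is none). -/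
def cell {d : ℕ} (Q : Set (Set (EuclideanSpace ℝ (Fin d)))) (x : EuclideanSpace ℝ (Fin d)) :
    Set (EuclideanSpace ℝ (Fin d)) :=
  ⋃₀ {B | B ∈ Q ∧ x ∈ B}

/-- The norm (mesh) of a partition: the largest Euclidean diameter of its members. -/
noncomputable def mesh {d : ℕ} (Q : Set (Set (EuclideanSpace ℝ (Fin d)))) : ENNReal :=
  ⨆ B ∈ Q, Metric.ediam B

/-- `h` is a (Borel) version of the regression function `x ↦ E(Y | X = x)`. -/
def IsRegressionFunction {Ω : Type*} [MeasurableSpace Ω] (P : Measure Ω) {d : ℕ}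
    (X : Ω → EuclideanSpace ℝ (Fin d)) (Y : Ω → ℝ) (h : EuclideanSpace ℝ (Fin d) → ℝ) : Prop :=
  Measurable h ∧ (fun ω => h (X ω)) =ᵐ[P] P[Y | MeasurableSpace.comap X inferInstance]

/-- The population cell average `E(Y; X ∈ B) / P(X ∈ B)`, where `B` is the cell of `x`. -/
noncomputable def cellMean {Ω : Type*} [MeasurableSpace Ω] (P : Measure Ω) {d : ℕ}
    (X : Ω → EuclideanSpace ℝ (Fin d)) (Y : Ω → ℝ)
    (Q : Set (Set (EuclideanSpace ℝ (Fin d)))) (x : EuclideanSpace ℝ (Fin d)) : ℝ :=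
  (∫ ω, Y ω * (cell Q x).indicator 1 (X ω) ∂P) / P.real (X ⁻¹' cell Q x)

/-- `(1 / N) ∑_{n=1}^N y_n 1_B(x_n)`. -/
noncomputable def empiricalSum {d : ℕ} (N : ℕ) (x : ℕ → EuclideanSpace ℝ (Fin d)) (y : ℕ → ℝ)
    (B : Set (EuclideanSpace ℝ (Fin d))) : ℝ :=
  (1 / (N : ℝ)) * ∑ n ∈ Finset.Icc 1 N, y n * B.indicator 1 (x n)

/-- The empirical probability `(1 / N) ∑_{n=1}^N 1_B(x_n)`. -/
noncomputable def empiricalProb {d : ℕ} (N : ℕ) (x : ℕ → EuclideanSpace ℝ (Fin d))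
    (B : Set (EuclideanSpace ℝ (Fin d))) : ℝ :=
  (1 / (N : ℝ)) * ∑ n ∈ Finset.Icc 1 N, B.indicator 1 (x n)

open Classical in
/-- The tree-structured regression estimate at `u` from the learning sample
`(x 1, y 1), …, (x N, y N)`: the average response over the cell of `u`, or `0` if that cell
contains no sample point. -/
noncomputable def cellEstimate {d : ℕ} (Q : Set (Set (EuclideanSpace ℝ (Fin d)))) (N : ℕ)
    (x : ℕ → EuclideanSpace ℝ (Fin d)) (y : ℕ → ℝ) (u : EuclideanSpace ℝ (Fin d)) : ℝ :=
  if 0 < empiricalProb N x (cell Q u) then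
    empiricalSum N x y (cell Q u) / empiricalProb N x (cell Q u)
  else 0

/-! Take noiseless data, `Y = h(X)`, with `h` integrable on the square but with averages over dyadic
rectangles of varying eccentricity that diverge almost everywhere: strong differentiation fails in
L¹.

To build `h`, fix a dyadic square of side 2^(-n). The rectangles with sides 2^(-(n+i)) and
2^(-(n+r-i)), `i < r`, at its lower left corner all contain the corner square of side 2^(-(n+r)) and
have 2^r times its area. A spike of height c·2^r on that corner square costs mass c·2^(-r) per unit
area, yet gives average at least `c` over each rectangle, and the rectangles cover a proportion at
least r·2^(-(r+1)): the factor `r` is the gain. `exists_block_lengths` picks `r j` and `c j → ∞`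
with Σ c·2^(-r) finite and Σ r·2^(-(r+1)) infinite. Using disjoint blocks of binary digits for
different `j` makes the covering events independent, so almost every point is covered infinitely
often (`ae_frequently_mem_leadingZeroSet`) and `exists_integrableOn_not_tendsto_average` follows.

For the estimate, the strong law on the finitely many cells of a fixed grid makes empirical and
population averages agree in the limit. If each grid is kept in use long enough before the next
(`exists_slow_diagonal`), the difference still tends to 0. Every grid is eventually used, so the
population averages still diverge, and the estimate cannot converge to `h` either. -/

/-! ### Dyadic floors -/

/-- The index of the dyadic interval `[p / 2 ^ n, (p + 1) / 2 ^ n)` that contains `t`. -/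
noncomputable def dyadicFloor (n : ℕ) (t : ℝ) : ℤ := ⌊(2 : ℝ) ^ n * t⌋

lemma dyadicFloor_eq_iff {n : ℕ} {t : ℝ} {p : ℤ} :
    dyadicFloor n t = p ↔ (p : ℝ) ≤ 2 ^ n * t ∧ 2 ^ n * t < p + 1 :=
  Int.floor_eq_iff

lemma dyadicFloor_le (n : ℕ) (t : ℝ) : (dyadicFloor n t : ℝ) ≤ 2 ^ n * t := Int.floor_le _

/-- Dividing by 2^i drops the last `i` binary digits. -/
lemma dyadicFloor_add_ediv (n i : ℕ) (t : ℝ) :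
    dyadicFloor (n + i) t / 2 ^ i = dyadicFloor n t := by
  have h := Int.natCast_mul_floor_div_cancel (n := 2 ^ i) (by positivity) ((2 : ℝ) ^ n * t)
  push_cast at h
  rw [dyadicFloor, dyadicFloor, ← h]
  congr 2
  ring

lemma dyadicFloor_eq_of_le {m n : ℕ} (hmn : m ≤ n) {s t : ℝ}
    (h : dyadicFloor n s = dyadicFloor n t) : dyadicFloor m s = dyadicFloor m t := by
  obtain ⟨i, rfl⟩ := Nat.exists_eq_add_of_le hmn
  rw [← dyadicFloor_add_ediv m i s, ← dyadicFloor_add_ediv m i t, h]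

lemma dyadicFloor_succ (n : ℕ) (t : ℝ) :
    dyadicFloor (n + 1) t = 2 * dyadicFloor n t ∨
      dyadicFloor (n + 1) t = 2 * dyadicFloor n t + 1 := by
  have := dyadicFloor_add_ediv n 1 t
  omega

lemma dyadicFloor_nonneg {n : ℕ} {t : ℝ} (ht : 0 ≤ t) : 0 ≤ dyadicFloor n t :=
  Int.floor_nonneg.2 (by positivity)

lemma dyadicFloor_lt {n : ℕ} {t : ℝ} (ht : t < 1) : dyadicFloor n t < 2 ^ n := by
  rw [dyadicFloor, Int.floor_lt]
  push_cast
  have : (0 : ℝ) < 2 ^ n := by positivity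
  nlinarith

lemma measurable_dyadicFloor (n : ℕ) : Measurable (dyadicFloor n) :=
  Int.measurable_floor.comp (measurable_const_mul _)

/-! ### Basic boxes and tree-structured partitions -/

lemma IsBasicHalfSpace.isBasicBox {d : ℕ} {H : Set (EuclideanSpace ℝ (Fin d))}
    (hH : IsBasicHalfSpace H) : IsBasicBox H :=
  ⟨{H}, by simpa using hH, by simp⟩

lemma IsBasicBox.iInter {d : ℕ} {ι : Type*} [Fintype ι]
    {B : ι → Set (EuclideanSpace ℝ (Fin d))} (hB : ∀ i, IsBasicBox (B i)) :
    IsBasicBox (⋂ i, B i) := by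
  classical
  choose S hS hBS using hB
  refine ⟨Finset.univ.biUnion S, ?_, ?_⟩
  · intro H hH
    obtain ⟨i, -, hi⟩ := Finset.mem_biUnion.1 hH
    exact hS i H hi
  · ext x
    simp only [Set.mem_iInter, hBS, Set.mem_ofPred_eq, Finset.mem_biUnion, Finset.mem_univ,
      true_and]
    exact ⟨fun h H ⟨i, hi⟩ => h i H hi, fun h i H hi => h H ⟨i, hi⟩⟩

lemma IsBasicBox.inter {d : ℕ} {B C : Set (EuclideanSpace ℝ (Fin d))} (hB : IsBasicBox B)
    (hC : IsBasicBox C) : IsBasicBox (B ∩ C) := by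
  rw [Set.inter_eq_iInter]
  exact IsBasicBox.iInter fun b => by cases b <;> assumption

lemma isBasicBox_unitCube (d : ℕ) : IsBasicBox (unitCube d) := by
  have : unitCube d = ⋂ i : Fin d,
      ({x | 1 * x i > 0} ∩ {x | (-1) * x i > -1} : Set (EuclideanSpace ℝ (Fin d))) := by
    ext x
    simp [unitCube]
  rw [this]
  exact IsBasicBox.iInter fun i => IsBasicBox.inter
    (IsBasicHalfSpace.isBasicBox ⟨i, 1, 0, one_ne_zero, Or.inr rfl⟩)
    (IsBasicHalfSpace.isBasicBox ⟨i, -1, -1, by norm_num, Or.inr rfl⟩)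

lemma isBasicBox_dyadicFloor_eq {d : ℕ} (i : Fin d) (n : ℕ) (p : ℤ) :
    IsBasicBox {x : EuclideanSpace ℝ (Fin d) | dyadicFloor n (x i) = p} := by
  -- Only `≤` and `>` are allowed, so an interval closed on the left needs negative normal vectors.
  have : {x : EuclideanSpace ℝ (Fin d) | dyadicFloor n (x i) = p} =
      {x | -(2 : ℝ) ^ n * x i ≤ -p} ∩ {x | -(2 : ℝ) ^ n * x i > -(p + 1)} := by
    ext x
    simp only [Set.mem_ofPred_eq, dyadicFloor_eq_iff, Set.mem_inter_iff]
    constructor <;> rintro ⟨h₁, h₂⟩ <;> constructor <;> linarith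
  rw [this]
  exact IsBasicBox.inter
    (IsBasicHalfSpace.isBasicBox ⟨i, -2 ^ n, -p, by simp, Or.inl rfl⟩)
    (IsBasicHalfSpace.isBasicBox ⟨i, -2 ^ n, -(p + 1), by simp, Or.inr rfl⟩)

/-- Grafting: a further tree is planted at every leaf, so successive refinements compose. -/
lemma IsTreePartition.bind {d : ℕ} {B : Set (EuclideanSpace ℝ (Fin d))}
    {Q : Set (Set (EuclideanSpace ℝ (Fin d)))} (h : IsTreePartition B Q)
    {F : Set (EuclideanSpace ℝ (Fin d)) → Set (Set (EuclideanSpace ℝ (Fin d)))}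
    (hF : ∀ C ∈ Q, IsTreePartition C (F C)) : IsTreePartition B (⋃ C ∈ Q, F C) := by
  induction h with
  | leaf hB hne => simpa using hF _ rfl
  | node hB hunion hdisj h₁ h₂ ih₁ ih₂ =>
    rw [Set.biUnion_union]
    exact .node hB hunion hdisj (ih₁ fun C hC => hF C (Or.inl hC))
      (ih₂ fun C hC => hF C (Or.inr hC))

/-! ### Dyadic product grids -/

/-- The cell of `x` in the grid that divides the `i`-th side of the unit cube into `2 ^ ℓ i`
intervals. -/
def dyadicCell {d : ℕ} (ℓ : Fin d → ℕ) (x : EuclideanSpace ℝ (Fin d)) :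
    Set (EuclideanSpace ℝ (Fin d)) :=
  unitCube d ∩ {z | ∀ i, dyadicFloor (ℓ i) (z i) = dyadicFloor (ℓ i) (x i)}

/-- The dyadic product grid with levels `ℓ`. -/
def dyadicGrid {d : ℕ} (ℓ : Fin d → ℕ) : Set (Set (EuclideanSpace ℝ (Fin d))) :=
  dyadicCell ℓ '' unitCube d

section Grid

variable {d : ℕ} {ℓ : Fin d → ℕ} {x y z : EuclideanSpace ℝ (Fin d)}

lemma mem_dyadicCell_self (hx : x ∈ unitCube d) : x ∈ dyadicCell ℓ x := ⟨hx, fun _ => rfl⟩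

lemma dyadicCell_eq_of_mem (h : y ∈ dyadicCell ℓ x) : dyadicCell ℓ y = dyadicCell ℓ x := by
  ext z
  exact and_congr_right fun _ => forall_congr' fun i => by rw [h.2 i]

lemma isBasicBox_dyadicCell : IsBasicBox (dyadicCell ℓ x) := by
  refine (isBasicBox_unitCube d).inter ?_
  rw [Set.ofPred_forall]
  exact IsBasicBox.iInter fun i => isBasicBox_dyadicFloor_eq i _ _

lemma cell_dyadicGrid (hx : x ∈ unitCube d) : cell (dyadicGrid ℓ) x = dyadicCell ℓ x := by
  ext z
  simp only [cell, Set.mem_sUnion, Set.mem_ofPred_eq]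
  constructor
  · rintro ⟨B, ⟨⟨y, hy, rfl⟩, hxB⟩, hz⟩
    rwa [dyadicCell_eq_of_mem hxB]
  · exact fun hz => ⟨_, ⟨⟨x, hx, rfl⟩, mem_dyadicCell_self hx⟩, hz⟩

lemma finite_dyadicGrid : (dyadicGrid ℓ).Finite := by
  have hfin : (Set.univ.pi fun i : Fin d => Set.Ico (0 : ℤ) (2 ^ ℓ i)).Finite :=
    Set.Finite.pi fun i => Set.finite_Ico _ _
  refine (hfin.image fun p => unitCube d ∩
    {z : EuclideanSpace ℝ (Fin d) | ∀ i, dyadicFloor (ℓ i) (z i) = p i}).subset ?_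
  rintro _ ⟨x, hx, rfl⟩
  exact ⟨fun i => dyadicFloor (ℓ i) (x i),
    fun i _ => ⟨dyadicFloor_nonneg (hx i).1.le, dyadicFloor_lt (hx i).2⟩, rfl⟩

/-- The lower inequality is strict because the cube is open: a cell touching a face of the cube
lacks its lower edge there. -/
lemma update_mem_dyadicCell (hx : x ∈ unitCube d) (i : Fin d) {t : ℝ}
    (h₁ : (dyadicFloor (ℓ i) (x i) : ℝ) < 2 ^ ℓ i * t)
    (h₂ : 2 ^ ℓ i * t < (dyadicFloor (ℓ i) (x i) : ℝ) + 1) :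
    (WithLp.toLp 2 (Function.update x.ofLp i t) : EuclideanSpace ℝ (Fin d)) ∈
      dyadicCell ℓ x := by
  have hpos : (0 : ℝ) < 2 ^ ℓ i := by positivity
  have h0 : (0 : ℝ) ≤ dyadicFloor (ℓ i) (x i) := by
    exact_mod_cast dyadicFloor_nonneg (hx i).1.le
  have h1 : (dyadicFloor (ℓ i) (x i) : ℝ) + 1 ≤ 2 ^ ℓ i := by
    exact_mod_cast dyadicFloor_lt (n := ℓ i) (hx i).2
  constructor
  · intro j
    by_cases hj : j = i
    · subst hj
      simp only [Function.update_self]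
      constructor <;> nlinarith
    · simpa [Function.update_of_ne hj] using hx j
  · intro j
    by_cases hj : j = i
    · subst hj
      simp only [Function.update_self]
      exact dyadicFloor_eq_iff.2 ⟨h₁.le, h₂⟩
    · simp [Function.update_of_ne hj]

lemma mem_dyadicCell_update_iff (i : Fin d) :
    z ∈ dyadicCell (Function.update ℓ i (ℓ i + 1)) x ↔
      z ∈ dyadicCell ℓ x ∧ dyadicFloor (ℓ i + 1) (z i) = dyadicFloor (ℓ i + 1) (x i) := by
  simp only [dyadicCell, Set.mem_inter_iff, Set.mem_ofPred_eq, and_assoc, and_congr_right_iff]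
  intro _
  constructor
  · intro h
    have hi : dyadicFloor (ℓ i + 1) (z i) = dyadicFloor (ℓ i + 1) (x i) := by simpa using h i
    refine ⟨fun j => ?_, hi⟩
    by_cases hj : j = i
    · subst hj
      exact dyadicFloor_eq_of_le (Nat.le_succ _) hi
    · simpa [Function.update_of_ne hj] using h j
  · rintro ⟨h, hi⟩ j
    by_cases hj : j = i
    · subst hj
      simpa using hi
    · simpa [Function.update_of_ne hj] using h j

lemma isTreePartition_dyadicCell_update (hx : x ∈ unitCube d) (i : Fin d) :
    IsTreePartition (dyadicCell ℓ x)
      (dyadicCell (Function.update ℓ i (ℓ i + 1)) '' dyadicCell ℓ x) := by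
  set ℓ' := Function.update ℓ i (ℓ i + 1)
  set p := dyadicFloor (ℓ i) (x i) with hp
  -- Both halves must be nonempty. The witnesses are their midpoints, at 1/4 and 3/4 of the `i`-th
  -- side.
  have key : ∀ c : ℤ, c = 0 ∨ c = 1 →
      ∃ y ∈ dyadicCell ℓ x, dyadicFloor (ℓ i + 1) (y i) = 2 * p + c := by
    intro c hc
    have hpow : (2 : ℝ) ^ ℓ i * ((p + (2 * c + 1) / 4) / 2 ^ ℓ i) = p + (2 * c + 1) / 4 := by
      field_simp
    refine ⟨_, update_mem_dyadicCell hx i (t := (p + (2 * c + 1) / 4) / 2 ^ ℓ i) ?_ ?_, ?_⟩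
    · rw [hpow, ← hp]
      rcases hc with rfl | rfl <;> norm_num
    · rw [hpow, ← hp]
      rcases hc with rfl | rfl <;> norm_num
    · simp only [Function.update_self]
      rw [dyadicFloor_eq_iff, pow_succ, mul_right_comm, hpow]
      rcases hc with rfl | rfl <;> push_cast <;> constructor <;> linarith
  obtain ⟨y₀, hy₀, hf₀⟩ := key 0 (Or.inl rfl)
  obtain ⟨y₁, hy₁, hf₁⟩ := key 1 (Or.inr rfl)
  have hz : ∀ z ∈ dyadicCell ℓ x, dyadicFloor (ℓ i + 1) (z i) = 2 * p + 0 ∨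
      dyadicFloor (ℓ i + 1) (z i) = 2 * p + 1 := by
    intro z hz
    have := dyadicFloor_succ (ℓ i) (z i)
    rw [hz.2 i] at this
    simpa using this
  have himage : dyadicCell ℓ' '' dyadicCell ℓ x = {dyadicCell ℓ' y₀} ∪ {dyadicCell ℓ' y₁} := by
    have hsame : ∀ y ∈ dyadicCell ℓ x, ∀ z ∈ dyadicCell ℓ x,
        dyadicFloor (ℓ i + 1) (z i) = dyadicFloor (ℓ i + 1) (y i) →
        dyadicCell ℓ' z = dyadicCell ℓ' y := by
      intro y hy z hz hyz
      refine dyadicCell_eq_of_mem ((mem_dyadicCell_update_iff i).2 ⟨?_, hyz⟩)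
      rwa [dyadicCell_eq_of_mem hy]
    ext C
    constructor
    · rintro ⟨z, hzx, rfl⟩
      rcases hz z hzx with h | h
      · exact Or.inl (hsame _ hy₀ z hzx (h.trans hf₀.symm))
      · exact Or.inr (hsame _ hy₁ z hzx (h.trans hf₁.symm))
    · rintro (rfl | rfl)
      exacts [⟨_, hy₀, rfl⟩, ⟨_, hy₁, rfl⟩]
  rw [himage]
  refine .node isBasicBox_dyadicCell ?_ ?_
    (.leaf isBasicBox_dyadicCell ⟨_, mem_dyadicCell_self hy₀.1⟩)
    (.leaf isBasicBox_dyadicCell ⟨_, mem_dyadicCell_self hy₁.1⟩)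
  · ext z
    rw [Set.mem_union, mem_dyadicCell_update_iff, mem_dyadicCell_update_iff,
      dyadicCell_eq_of_mem hy₀, dyadicCell_eq_of_mem hy₁, hf₀, hf₁, ← and_or_left]
    exact ⟨fun h => h.1, fun h => ⟨h, hz z h⟩⟩
  · rw [Set.disjoint_left]
    intro z h₀ h₁
    rw [mem_dyadicCell_update_iff] at h₀ h₁
    have := h₀.2.symm.trans h₁.2
    omega

lemma dyadicGrid_zero (hd : (unitCube d).Nonempty) : dyadicGrid (0 : Fin d → ℕ) = {unitCube d} := by
  have hfloor : ∀ x ∈ unitCube d, ∀ i, dyadicFloor 0 (x i) = 0 := by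
    intro x hx i
    rw [dyadicFloor_eq_iff]
    have := hx i
    constructor <;> norm_num <;> linarith
  have : ∀ x ∈ unitCube d, dyadicCell 0 x = unitCube d := by
    intro x hx
    refine Set.inter_eq_left.2 fun z hz i => ?_
    simp only [Pi.zero_apply]
    rw [hfloor x hx, hfloor z hz]
  rw [dyadicGrid, Set.image_congr this, hd.image_const]

lemma unitCube_nonempty (d : ℕ) : (unitCube d).Nonempty :=
  ⟨WithLp.toLp 2 fun _ => 1 / 2, fun i => by norm_num⟩

/-- Induction on the total level: lower one positive level by 1, then halve every cell of that
coarser grid along this coordinate. -/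
lemma isTreePartition_dyadicGrid (ℓ : Fin d → ℕ) : IsTreePartition (unitCube d) (dyadicGrid ℓ) := by
  induction hn : ∑ i, ℓ i generalizing ℓ with
  | zero =>
    have : ℓ = 0 := by
      ext i
      simpa using Finset.sum_eq_zero_iff.1 hn i (Finset.mem_univ i)
    rw [this, dyadicGrid_zero (unitCube_nonempty d)]
    exact .leaf (isBasicBox_unitCube d) (unitCube_nonempty d)
  | succ n ih =>
    obtain ⟨i, hi⟩ : ∃ i, ℓ i ≠ 0 := by
      by_contra! h
      simp [h] at hn
    set ℓ₀ := Function.update ℓ i (ℓ i - 1)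
    have hℓ : ℓ = Function.update ℓ₀ i (ℓ₀ i + 1) := by
      ext j
      by_cases hj : j = i
      · subst hj
        simp [ℓ₀]
        omega
      · simp [ℓ₀, hj]
    have hsum : ∑ i, ℓ₀ i = n := by
      have h₁ := Finset.sum_update_of_mem (Finset.mem_univ i) ℓ (ℓ i - 1)
      have h₂ := Finset.add_sum_erase Finset.univ ℓ (Finset.mem_univ i)
      rw [Finset.sdiff_singleton_eq_erase] at h₁
      simp only [ℓ₀]
      omega
    have := (ih ℓ₀ hsum).bind
      (F := fun C => dyadicCell (Function.update ℓ₀ i (ℓ₀ i + 1)) '' C)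
      (by rintro _ ⟨x, hx, rfl⟩; exact isTreePartition_dyadicCell_update hx i)
    convert this
    rw [← hℓ]
    ext C
    simp only [dyadicGrid, Set.mem_image, Set.mem_iUnion, exists_prop, exists_exists_and_eq_and]
    constructor
    · rintro ⟨x, hx, rfl⟩
      exact ⟨x, hx, x, mem_dyadicCell_self hx, rfl⟩
    · rintro ⟨x, hx, z, hz, rfl⟩
      exact ⟨z, hz.1, rfl⟩

lemma measurableSet_unitCube (d : ℕ) : MeasurableSet (unitCube d) := by
  simp only [unitCube, Set.ofPred_forall]
  exact MeasurableSet.iInter fun i => (measurableSet_Ioo (a := (0 : ℝ)) (b := 1)).preimage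
    (by fun_prop : Measurable fun x : EuclideanSpace ℝ (Fin d) => x i)

lemma measurableSet_dyadicCell : MeasurableSet (dyadicCell ℓ x) := by
  refine (measurableSet_unitCube d).inter ?_
  rw [Set.ofPred_forall]
  exact MeasurableSet.iInter fun i => (measurableSet_singleton _).preimage
    ((measurable_dyadicFloor _).comp
      (by fun_prop : Measurable fun x : EuclideanSpace ℝ (Fin d) => x i))

lemma EuclideanSpace.volume_setOf_forall_mem (s : Fin d → Set ℝ) :
    volume {x : EuclideanSpace ℝ (Fin d) | ∀ i, x i ∈ s i} = ∏ i, volume (s i) := by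
  have := (EuclideanSpace.volume_preserving_symm_measurableEquiv_toLp (Fin d)).measure_preimage_equiv
    (Set.univ.pi s)
  rw [volume_pi_pi] at this
  rw [← this]
  congr 1
  ext x
  simp

lemma volume_unitCube (d : ℕ) : volume (unitCube d) = 1 := by
  have := EuclideanSpace.volume_setOf_forall_mem (d := d) fun _ => Set.Ioo 0 1
  simpa [unitCube] using this

lemma volume_dyadicCell_le :
    volume (dyadicCell ℓ x) ≤ ∏ i, ENNReal.ofReal ((2 ^ ℓ i)⁻¹) := by
  calc volume (dyadicCell ℓ x)
      ≤ volume {z : EuclideanSpace ℝ (Fin d) | ∀ i, z i ∈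
          Set.Ico ((dyadicFloor (ℓ i) (x i) : ℝ) / 2 ^ ℓ i)
            (((dyadicFloor (ℓ i) (x i) : ℝ) + 1) / 2 ^ ℓ i)} := by
        refine measure_mono fun z hz i => ?_
        have := dyadicFloor_eq_iff.1 (hz.2 i)
        have hpos : (0 : ℝ) < 2 ^ ℓ i := by positivity
        rw [Set.mem_Ico, div_le_iff₀ hpos, lt_div_iff₀ hpos, mul_comm (z i)]
        exact this
    _ = ∏ i, ENNReal.ofReal ((2 ^ ℓ i)⁻¹) := by
        rw [EuclideanSpace.volume_setOf_forall_mem]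
        refine Finset.prod_congr rfl fun i _ => ?_
        rw [Real.volume_Ico]
        congr 1
        ring

lemma volume_dyadicCell_pos (hx : x ∈ unitCube d) : 0 < volume (dyadicCell ℓ x) := by
  have hsub : {z : EuclideanSpace ℝ (Fin d) | ∀ i, z i ∈
          Set.Ioo ((dyadicFloor (ℓ i) (x i) : ℝ) / 2 ^ ℓ i)
            (((dyadicFloor (ℓ i) (x i) : ℝ) + 1) / 2 ^ ℓ i)} ⊆ dyadicCell ℓ x := by
    intro z hz
    have hz' : ∀ i, (dyadicFloor (ℓ i) (x i) : ℝ) < 2 ^ ℓ i * z i ∧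
        2 ^ ℓ i * z i < (dyadicFloor (ℓ i) (x i) : ℝ) + 1 := by
      intro i
      have hpos : (0 : ℝ) < 2 ^ ℓ i := by positivity
      have := hz i
      rwa [Set.mem_Ioo, div_lt_iff₀ hpos, lt_div_iff₀ hpos, mul_comm (z i)] at this
    refine ⟨fun i => ?_, fun i => dyadicFloor_eq_iff.2 ⟨(hz' i).1.le, (hz' i).2⟩⟩
    have hpos : (0 : ℝ) < 2 ^ ℓ i := by positivity
    have h0 : (0 : ℝ) ≤ dyadicFloor (ℓ i) (x i) := by
      exact_mod_cast dyadicFloor_nonneg (hx i).1.le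
    have h1 : (dyadicFloor (ℓ i) (x i) : ℝ) + 1 ≤ 2 ^ ℓ i := by
      exact_mod_cast dyadicFloor_lt (n := ℓ i) (hx i).2
    have := hz' i
    constructor <;> nlinarith
  refine lt_of_lt_of_le ?_ (measure_mono hsub)
  rw [EuclideanSpace.volume_setOf_forall_mem, pos_iff_ne_zero, Finset.prod_ne_zero_iff]
  intro i _
  rw [Real.volume_Ioo, ← sub_div, ← pos_iff_ne_zero, ENNReal.ofReal_pos]
  simp

lemma mesh_dyadicGrid_le {m : ℕ} (hm : ∀ i, m ≤ ℓ i) :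
    mesh (dyadicGrid ℓ) ≤ ENNReal.ofReal (√d * (2 ^ m)⁻¹) := by
  refine iSup₂_le ?_
  rintro _ ⟨x, hx, rfl⟩
  refine Metric.ediam_le fun y hy z hz => ?_
  rw [edist_dist]
  refine ENNReal.ofReal_le_ofReal ?_
  have hcoord : ∀ i, dist (y i) (z i) ^ 2 ≤ ((2 ^ m)⁻¹ : ℝ) ^ 2 := by
    intro i
    have hyi := dyadicFloor_eq_iff.1 (dyadicFloor_eq_of_le (hm i) (hy.2 i))
    have hzi := dyadicFloor_eq_iff.1 (dyadicFloor_eq_of_le (hm i) (hz.2 i))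
    have hpos : (0 : ℝ) < 2 ^ m := by positivity
    refine pow_le_pow_left₀ dist_nonneg ?_ 2
    rw [Real.dist_eq, ← one_div, le_div_iff₀ hpos]
    rcases abs_cases (y i - z i) with ⟨h, -⟩ | ⟨h, -⟩ <;> rw [h] <;> nlinarith
  rw [EuclideanSpace.dist_eq]
  calc √(∑ i, dist (y i) (z i) ^ 2) ≤ √(∑ _i : Fin d, ((2 ^ m)⁻¹ : ℝ) ^ 2) :=
        Real.sqrt_le_sqrt (Finset.sum_le_sum fun i _ => hcoord i)
    _ = √d * (2 ^ m)⁻¹ := by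
        rw [Finset.sum_const, Finset.card_univ, Fintype.card_fin, nsmul_eq_mul,
          Real.sqrt_mul (Nat.cast_nonneg d), Real.sqrt_sq (by positivity)]

end Grid

/-! ### Independence of dyadic floors and fractional parts -/

/-- The half-open unit cube. -/
def halfOpenCube (d : ℕ) : Set (EuclideanSpace ℝ (Fin d)) :=
  {x | ∀ i, x i ∈ Set.Ico 0 1}

/-- The coordinatewise fractional part of `2 ^ n • x`. -/
noncomputable def dyadicFract {d : ℕ} (n : ℕ) (x : EuclideanSpace ℝ (Fin d)) :
    EuclideanSpace ℝ (Fin d) :=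
  WithLp.toLp 2 fun i => Int.fract ((2 : ℝ) ^ n * x i)

/-- `D` is a union of dyadic cubes of side `2 ^ (-n)`. -/
def IsDyadicSet {d : ℕ} (n : ℕ) (D : Set (EuclideanSpace ℝ (Fin d))) : Prop :=
  ∀ ⦃x y⦄, (∀ i, dyadicFloor n (x i) = dyadicFloor n (y i)) → x ∈ D → y ∈ D

section Independence

variable {d : ℕ} {D E : Set (EuclideanSpace ℝ (Fin d))}

lemma unitCube_subset_halfOpenCube : unitCube d ⊆ halfOpenCube d :=
  fun _ hx i => ⟨(hx i).1.le, (hx i).2⟩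

lemma dyadicFract_mem_halfOpenCube (n : ℕ) (x : EuclideanSpace ℝ (Fin d)) :
    dyadicFract n x ∈ halfOpenCube d :=
  fun _ => ⟨Int.fract_nonneg _, Int.fract_lt_one _⟩

lemma measurable_dyadicFract (n : ℕ) :
    Measurable (dyadicFract n : EuclideanSpace ℝ (Fin d) → EuclideanSpace ℝ (Fin d)) := by
  unfold dyadicFract
  fun_prop

lemma measurableSet_setOf_forall_mem {s : Fin d → Set ℝ} (hs : ∀ i, MeasurableSet (s i)) :
    MeasurableSet {x : EuclideanSpace ℝ (Fin d) | ∀ i, x i ∈ s i} := by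
  rw [Set.ofPred_forall]
  exact MeasurableSet.iInter fun i => (hs i).preimage
    (by fun_prop : Measurable fun x : EuclideanSpace ℝ (Fin d) => x i)

lemma measurableSet_halfOpenCube : MeasurableSet (halfOpenCube d) :=
  measurableSet_setOf_forall_mem fun _ => measurableSet_Ico

lemma volume_halfOpenCube (d : ℕ) : volume (halfOpenCube d) = 1 := by
  have := EuclideanSpace.volume_setOf_forall_mem (d := d) fun _ => Set.Ico 0 1
  simpa [halfOpenCube] using this

lemma IsDyadicSet.mono {m n : ℕ} (hD : IsDyadicSet m D) (hmn : m ≤ n) : IsDyadicSet n D :=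
  fun _ _ h => hD fun i => dyadicFloor_eq_of_le hmn (h i)

lemma IsDyadicSet.inter {n : ℕ} (hD : IsDyadicSet n D) (hE : IsDyadicSet n E) :
    IsDyadicSet n (D ∩ E) :=
  fun _ _ h hx => ⟨hD h hx.1, hE h hx.2⟩

lemma IsDyadicSet.compl {n : ℕ} (hD : IsDyadicSet n D) : IsDyadicSet n Dᶜ :=
  fun _ _ h hx hy => hx (hD (fun i => (h i).symm) hy)

lemma isDyadicSet_halfOpenCube (n : ℕ) : IsDyadicSet n (halfOpenCube d) := by
  refine IsDyadicSet.mono (fun x y h hx i => ?_) (Nat.zero_le n)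
  have hfl : ∀ t : ℝ, t ∈ Set.Ico (0 : ℝ) 1 ↔ dyadicFloor 0 t = 0 := by
    intro t
    simp [dyadicFloor_eq_iff]
  rw [hfl, ← h i, ← hfl]
  exact hx i

lemma volume_preimage_smul_sub (n : ℕ) (p : EuclideanSpace ℝ (Fin d))
    (E : Set (EuclideanSpace ℝ (Fin d))) :
    volume ((fun z => (2 : ℝ) ^ n • z - p) ⁻¹' E) =
      ENNReal.ofReal |(((2 : ℝ) ^ n) ^ d)⁻¹| * volume E := by
  have h : (fun z => (2 : ℝ) ^ n • z - p) ⁻¹' E =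
      (fun z => (2 : ℝ) ^ n • z) ⁻¹' ((fun z => z + -p) ⁻¹' E) := by
    ext z
    simp [sub_eq_add_neg]
  rw [h, Measure.addHaar_preimage_smul _ (by positivity), measure_preimage_add_right,
    finrank_euclideanSpace_fin]

/-- Independence of the first `n` binary digits from the later ones. On each dyadic cube `p` of `D`,
`dyadicFract n` is the affine map `aff p` onto the half-open unit cube, with the same Jacobian for
all `p`. -/
lemma IsDyadicSet.volume_inter_preimage_dyadicFract {n : ℕ} (hD : IsDyadicSet n D)
    (hE : MeasurableSet E) (hEs : E ⊆ halfOpenCube d) :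
    volume (D ∩ dyadicFract n ⁻¹' E) = volume D * volume E := by
  set T : Set (Fin d → ℤ) := (fun x i => dyadicFloor n (x i)) '' D with hT
  set aff : (Fin d → ℤ) → EuclideanSpace ℝ (Fin d) → EuclideanSpace ℝ (Fin d) :=
    fun p z => (2 : ℝ) ^ n • z - WithLp.toLp 2 fun i => (p i : ℝ) with haff
  have hfloor : ∀ p z, aff p z ∈ halfOpenCube d → ∀ i, dyadicFloor n (z i) = p i := by
    intro p z hz i
    have := hz i
    simp only [haff, PiLp.sub_apply, PiLp.smul_apply, smul_eq_mul, Set.mem_Ico] at this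
    rw [dyadicFloor_eq_iff]
    constructor <;> linarith
  have hfract : ∀ p z, (∀ i, dyadicFloor n (z i) = p i) → dyadicFract n z = aff p z := by
    intro p z h
    ext i
    simp only [dyadicFract, haff, PiLp.sub_apply, PiLp.smul_apply, smul_eq_mul, ← h i]
    rfl
  have main : ∀ A ⊆ halfOpenCube d, MeasurableSet A → volume (D ∩ dyadicFract n ⁻¹' A) =
      ∑' _ : T, ENNReal.ofReal |(((2 : ℝ) ^ n) ^ d)⁻¹| * volume A := by
    intro A hA hAm
    have hU : D ∩ dyadicFract n ⁻¹' A = ⋃ p ∈ T, aff p ⁻¹' A := by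
      ext z
      simp only [Set.mem_inter_iff, Set.mem_preimage, Set.mem_iUnion, exists_prop]
      constructor
      · rintro ⟨hz, hzA⟩
        refine ⟨_, ⟨z, hz, rfl⟩, ?_⟩
        rwa [← hfract _ z fun i => rfl]
      · rintro ⟨p, ⟨y, hy, rfl⟩, hz⟩
        have := hfloor _ z (hA hz)
        exact ⟨hD (fun i => (this i).symm) hy, by rwa [hfract _ z this]⟩
    rw [hU, measure_biUnion T.to_countable]
    · exact tsum_congr fun p => volume_preimage_smul_sub n _ A
    · intro p _ q _ hpq
      refine Set.disjoint_left.2 fun z hp hq => hpq ?_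
      ext i
      rw [← hfloor p z (hA hp) i, hfloor q z (hA hq) i]
    · intro p _
      exact hAm.preimage (by simp only [haff]; fun_prop)
  -- With the full cube in place of `E` the same sum computes `volume D`, so the cubes, possibly
  -- infinitely many, need not be counted.
  have hDD := main _ subset_rfl measurableSet_halfOpenCube
  rw [show D ∩ dyadicFract n ⁻¹' halfOpenCube d = D from
    Set.inter_eq_left.2 fun z _ => dyadicFract_mem_halfOpenCube n z, volume_halfOpenCube] at hDD
  rw [main E hEs hE, hDD, ENNReal.tsum_mul_right, ENNReal.tsum_mul_right, mul_one]

end Independence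

/-! ### Blocks of leading zeros -/

/-- Both sides say that the binary digits of `t` in places `n + 1` to `n + i` vanish. -/
lemma fract_lt_iff_dyadicFloor_add (n i : ℕ) (t : ℝ) :
    Int.fract ((2 : ℝ) ^ n * t) < (2 ^ i)⁻¹ ↔
      dyadicFloor (n + i) t = 2 ^ i * dyadicFloor n t := by
  have hpos : (0 : ℝ) < 2 ^ i := by positivity
  have hle := dyadicFloor_le n t
  rw [dyadicFloor_eq_iff, ← one_div, lt_div_iff₀ hpos, Int.fract, pow_add]
  change (2 ^ n * t - (dyadicFloor n t : ℝ)) * 2 ^ i < 1 ↔ _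
  push_cast
  constructor
  · intro h
    constructor <;> nlinarith
  · rintro ⟨h₁, h₂⟩
    linarith

/-- The points of the half-open unit square whose coordinates have binary expansions with
exactly `i` and at least `r - i` leading zeros, for some `i < r`. -/
def leadingZeroSet (r : ℕ) : Set (EuclideanSpace ℝ (Fin 2)) :=
  ⋃ i ∈ Finset.range r, {x | ∀ k, x k ∈
    (![Set.Ico (2 ^ (i + 1))⁻¹ (2 ^ i)⁻¹, Set.Ico 0 (2 ^ (r - i))⁻¹] : Fin 2 → Set ℝ) k}

lemma mem_leadingZeroSet {r : ℕ} {x : EuclideanSpace ℝ (Fin 2)} :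
    x ∈ leadingZeroSet r ↔ ∃ i < r, ((2 ^ (i + 1))⁻¹ ≤ x 0 ∧ x 0 < (2 ^ i)⁻¹) ∧
      0 ≤ x 1 ∧ x 1 < (2 ^ (r - i))⁻¹ := by
  simp only [leadingZeroSet, Set.mem_iUnion, Finset.mem_range, exists_prop, Set.mem_ofPred_eq,
    Fin.forall_fin_two, Matrix.cons_val_zero, Matrix.cons_val_one, Set.mem_Ico]

lemma measurableSet_leadingZeroPiece (r i : ℕ) :
    MeasurableSet {x : EuclideanSpace ℝ (Fin 2) | ∀ k, x k ∈
      (![Set.Ico (2 ^ (i + 1))⁻¹ (2 ^ i)⁻¹, Set.Ico 0 (2 ^ (r - i))⁻¹] : Fin 2 → Set ℝ) k} := by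
  refine measurableSet_setOf_forall_mem fun k => ?_
  fin_cases k <;> exact measurableSet_Ico

lemma measurableSet_leadingZeroSet (r : ℕ) : MeasurableSet (leadingZeroSet r) :=
  Finset.measurableSet_biUnion _ fun i _ => measurableSet_leadingZeroPiece r i

lemma leadingZeroSet_subset_halfOpenCube (r : ℕ) : leadingZeroSet r ⊆ halfOpenCube 2 := by
  intro x hx
  obtain ⟨i, -, ⟨h₁, h₂⟩, h₃, h₄⟩ := mem_leadingZeroSet.1 hx
  have hinv : ∀ m : ℕ, ((2 : ℝ) ^ m)⁻¹ ≤ 1 := fun m => inv_le_one_of_one_le₀ (one_le_pow₀ one_le_two)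
  have hpos : (0 : ℝ) ≤ (2 ^ (i + 1))⁻¹ := by positivity
  intro k
  fin_cases k
  · exact ⟨hpos.trans h₁, h₂.trans_le (hinv i)⟩
  · exact ⟨h₃, h₄.trans_le (hinv _)⟩

/-- Each of the `r` pieces has area 2^(-(i+1))·2^(-(r-i)), independent of `i`. Prescribing the exact
number of zeros in the first coordinate makes the pieces disjoint. -/
lemma volume_leadingZeroSet (r : ℕ) :
    volume (leadingZeroSet r) = ENNReal.ofReal (r * (1 / 2) ^ (r + 1)) := by
  rw [leadingZeroSet, measure_biUnion_finset _ fun i _ => measurableSet_leadingZeroPiece r i]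
  · have : ∀ i ∈ Finset.range r, volume {x : EuclideanSpace ℝ (Fin 2) | ∀ k, x k ∈
      (![Set.Ico (2 ^ (i + 1))⁻¹ (2 ^ i)⁻¹, Set.Ico 0 (2 ^ (r - i))⁻¹] : Fin 2 → Set ℝ) k} =
        ENNReal.ofReal ((1 / 2) ^ (r + 1)) := by
      intro i hi
      rw [EuclideanSpace.volume_setOf_forall_mem]
      simp only [Fin.prod_univ_two, Matrix.cons_val_zero, Matrix.cons_val_one, Real.volume_Ico]
      rw [← ENNReal.ofReal_mul]
      · congr 1
        have : r + 1 = (i + 1) + (r - i) := by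
          have := Finset.mem_range.1 hi
          omega
        rw [this, pow_add (1 / 2 : ℝ) (i + 1), pow_succ (2 : ℝ), pow_succ (1 / 2 : ℝ)]
        simp only [one_div, inv_pow]
        field_simp
        norm_num
      · rw [sub_nonneg]
        exact inv_anti₀ (by positivity) (pow_le_pow_right₀ one_le_two (Nat.le_succ i))
    rw [Finset.sum_congr rfl this, Finset.sum_const, Finset.card_range, nsmul_eq_mul,
      ENNReal.ofReal_mul (Nat.cast_nonneg r), ENNReal.ofReal_natCast]
  · intro i _ j _ hij
    refine Set.disjoint_left.2 fun x hi hj => ?_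
    have hi := hi 0
    have hj := hj 0
    simp only [Matrix.cons_val_zero, Set.mem_Ico] at hi hj
    have key : ∀ a b : ℕ, a < b → (2 ^ (a + 1))⁻¹ ≤ x 0 → x 0 < (2 ^ b)⁻¹ → False := by
      intro a b hab h₁ h₂
      exact absurd (h₁.trans_lt h₂) (not_lt.2
        (inv_anti₀ (by positivity) (pow_le_pow_right₀ one_le_two hab)))
    rcases lt_or_gt_of_ne hij with h | h
    exacts [key i j h hi.1 hj.2, key j i h hj.1 hi.2]

lemma isDyadicSet_preimage_leadingZeroSet (n r : ℕ) :
    IsDyadicSet (n + r) (dyadicFract n ⁻¹' leadingZeroSet r) := by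
  have key : ∀ {s t : ℝ} {i : ℕ}, i ≤ r → dyadicFloor (n + r) s = dyadicFloor (n + r) t →
      (Int.fract ((2 : ℝ) ^ n * s) < (2 ^ i)⁻¹ ↔ Int.fract ((2 : ℝ) ^ n * t) < (2 ^ i)⁻¹) := by
    intro s t i hi h
    rw [fract_lt_iff_dyadicFloor_add, fract_lt_iff_dyadicFloor_add,
      dyadicFloor_eq_of_le (Nat.add_le_add_left hi n) h, dyadicFloor_eq_of_le (Nat.le_add_right n r) h]
  intro x y hxy hx
  obtain ⟨i, hi, ⟨h₁, h₂⟩, h₃, h₄⟩ := mem_leadingZeroSet.1 hx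
  refine mem_leadingZeroSet.2 ⟨i, hi, ⟨?_, ?_⟩, Int.fract_nonneg _, ?_⟩
  · exact not_lt.1 fun h => not_lt.2 h₁ ((key hi (hxy 0)).2 h)
  · exact (key hi.le (hxy 0)).1 h₂
  · exact (key (Nat.sub_le r i) (hxy 1)).1 h₄

section BorelCantelli

variable {n r : ℕ → ℕ}

/-- The first `m` conditions involve only digits up to place `n m`, the next one only the `r m`
digits after it. By independence the measure is the product of the factors 1 - r·2^(-(r+1)), and 1 -
t ≤ exp(-t). -/
lemma volume_forall_lt_notMem_le (hn : ∀ j, n (j + 1) = n j + r j) (m : ℕ) :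
    volume {x | x ∈ halfOpenCube 2 ∧ ∀ j < m, x ∉ dyadicFract (n j) ⁻¹' leadingZeroSet (r j)} ≤
      ENNReal.ofReal (Real.exp (-∑ j ∈ Finset.range m, (r j : ℝ) * (1 / 2) ^ (r j + 1))) := by
  set S : ℕ → Set (EuclideanSpace ℝ (Fin 2)) := fun m =>
    {x | x ∈ halfOpenCube 2 ∧ ∀ j < m, x ∉ dyadicFract (n j) ⁻¹' leadingZeroSet (r j)} with hS
  have hsucc : ∀ m, S (m + 1) = S m ∩ (dyadicFract (n m) ⁻¹' leadingZeroSet (r m))ᶜ := by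
    intro m
    ext x
    simp only [hS, Set.mem_inter_iff, Set.mem_ofPred_eq, Set.mem_compl_iff, Nat.forall_lt_succ_right,
      and_assoc]
  have hdy : ∀ m, IsDyadicSet (n m) (S m) := by
    intro m
    induction m with
    | zero => simpa [hS] using isDyadicSet_halfOpenCube (n 0)
    | succ m ih =>
      rw [hsucc, hn]
      exact (ih.mono (Nat.le_add_right _ _)).inter (isDyadicSet_preimage_leadingZeroSet _ _).compl
  change volume (S m) ≤ _
  induction m with
  | zero => simp [hS, volume_halfOpenCube]
  | succ m ih =>
    have hsplit : S (m + 1) = S m ∩ dyadicFract (n m) ⁻¹' (halfOpenCube 2 \ leadingZeroSet (r m)) := by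
      rw [hsucc]
      ext x
      simp [dyadicFract_mem_halfOpenCube]
    rw [hsplit, (hdy m).volume_inter_preimage_dyadicFract
      (measurableSet_halfOpenCube.diff (measurableSet_leadingZeroSet _)) Set.sdiff_subset,
      measure_sdiff (leadingZeroSet_subset_halfOpenCube _)
        (measurableSet_leadingZeroSet _).nullMeasurableSet
        (by rw [volume_leadingZeroSet]; exact ENNReal.ofReal_ne_top),
      volume_halfOpenCube, volume_leadingZeroSet, Finset.sum_range_succ, neg_add, Real.exp_add,
      ENNReal.ofReal_mul (Real.exp_nonneg _)]
    refine mul_le_mul' ih ?_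
    rw [← ENNReal.ofReal_one, ← ENNReal.ofReal_sub _ (by positivity)]
    refine ENNReal.ofReal_le_ofReal ?_
    have := Real.add_one_le_exp (-((r m : ℝ) * (1 / 2) ^ (r m + 1)))
    linarith

lemma ae_exists_mem_leadingZeroSet (hn : ∀ j, n (j + 1) = n j + r j)
    (hr : ¬ Summable fun j => (r j : ℝ) * (1 / 2) ^ (r j + 1)) :
    ∀ᵐ x ∂volume.restrict (unitCube 2), ∃ j, dyadicFract (n j) x ∈ leadingZeroSet (r j) := by
  rw [ae_restrict_iff' (measurableSet_unitCube 2), ae_iff]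
  have hlim : Tendsto (fun m => ENNReal.ofReal
      (Real.exp (-∑ j ∈ Finset.range m, (r j : ℝ) * (1 / 2) ^ (r j + 1)))) atTop (𝓝 0) := by
    rw [← ENNReal.ofReal_zero]
    refine ENNReal.tendsto_ofReal (Real.tendsto_exp_neg_atTop_nhds_zero.comp ?_)
    exact (not_summable_iff_tendsto_nat_atTop_of_nonneg fun j => by positivity).1 hr
  refine le_antisymm (ge_of_tendsto' hlim fun m => ?_) zero_le
  refine (measure_mono ?_).trans (volume_forall_lt_notMem_le hn m)
  intro x hx
  simp only [Set.mem_ofPred_eq, Classical.not_imp, not_exists] at hx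
  exact ⟨unitCube_subset_halfOpenCube hx.1, fun j _ => hx.2 j⟩

/-- Second Borel–Cantelli: deleting the first `l` blocks preserves both hypotheses, so a block with
index at least `l` occurs almost surely. -/
lemma ae_frequently_mem_leadingZeroSet (hn : ∀ j, n (j + 1) = n j + r j)
    (hr : ¬ Summable fun j => (r j : ℝ) * (1 / 2) ^ (r j + 1)) :
    ∀ᵐ x ∂volume.restrict (unitCube 2),
      ∃ᶠ j in atTop, dyadicFract (n j) x ∈ leadingZeroSet (r j) := by
  have : ∀ l, ∀ᵐ x ∂volume.restrict (unitCube 2),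
      ∃ j, dyadicFract (n (j + l)) x ∈ leadingZeroSet (r (j + l)) := by
    intro l
    refine ae_exists_mem_leadingZeroSet (n := fun j => n (j + l)) (r := fun j => r (j + l))
      (fun j => ?_) ?_
    · rw [← hn, Nat.add_right_comm]
    · rwa [summable_nat_add_iff (f := fun j => (r j : ℝ) * (1 / 2) ^ (r j + 1)) l]
  filter_upwards [ae_all_iff.2 this] with x hx
  refine frequently_atTop.2 fun l => ?_
  obtain ⟨j, hj⟩ := hx l
  exact ⟨j + l, Nat.le_add_left l j, hj⟩

end BorelCantelli

/-! ### A function whose averages over dyadic rectangles diverge -/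

/-- The corner square of side `2 ^ (-r)` at the origin. -/
def cornerSet (r : ℕ) : Set (EuclideanSpace ℝ (Fin 2)) :=
  {x | ∀ i, x i ∈ Set.Ico 0 (2 ^ r)⁻¹}

lemma measurableSet_cornerSet (r : ℕ) : MeasurableSet (cornerSet r) :=
  measurableSet_setOf_forall_mem fun _ => measurableSet_Ico

lemma cornerSet_subset_halfOpenCube (r : ℕ) : cornerSet r ⊆ halfOpenCube 2 :=
  fun _ hx i => ⟨(hx i).1, (hx i).2.trans_le (inv_le_one_of_one_le₀ (one_le_pow₀ one_le_two))⟩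

lemma volume_cornerSet (r : ℕ) : volume (cornerSet r) = ENNReal.ofReal ((1 / 2) ^ (2 * r)) := by
  rw [cornerSet, EuclideanSpace.volume_setOf_forall_mem fun _ => Set.Ico 0 (2 ^ r)⁻¹,
    Finset.prod_const, Finset.card_univ, Fintype.card_fin, Real.volume_Ico,
    ← ENNReal.ofReal_pow (by simp)]
  congr 1
  rw [sub_zero, ← inv_pow, ← pow_mul, mul_comm, one_div]

/-- If `x` has a block of leading zeros, then one of the dyadic rectangles of area
`2 ^ (-(2 * n + r))` around `x` contains a corner square of the dyadic square of side `2 ^ (-n)`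
around `x`. -/
lemma exists_volume_dyadicCell_mul_le {n r : ℕ} {x : EuclideanSpace ℝ (Fin 2)}
    (hx : x ∈ unitCube 2) (hz : dyadicFract n x ∈ leadingZeroSet r) :
    ∃ i < r, volume (dyadicCell ![n + i, n + (r - i)] x) * ENNReal.ofReal ((1 / 2) ^ r) ≤
      volume (dyadicFract n ⁻¹' cornerSet r ∩ dyadicCell ![n + i, n + (r - i)] x) := by
  obtain ⟨i, hi, ⟨-, h₁⟩, -, h₂⟩ := mem_leadingZeroSet.1 hz
  refine ⟨i, hi, ?_⟩
  -- The zeros in the digits of `x` say that the rectangle around `x` sits at the lower left corner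
  -- of its dyadic square of side 2^(-n).
  have h₁ := (fract_lt_iff_dyadicFloor_add n i (x 0)).1 h₁
  have h₂ := (fract_lt_iff_dyadicFloor_add n (r - i) (x 1)).1 h₂
  have hpn : (0 : ℝ) < 2 ^ n := by positivity
  -- The open corner square: the closed edges could lie on the boundary of the unit cube.
  set S : Set (EuclideanSpace ℝ (Fin 2)) := {z | ∀ k, z k ∈
    Set.Ioo ((dyadicFloor n (x k) : ℝ) / 2 ^ n)
      ((dyadicFloor n (x k) : ℝ) / 2 ^ n + (2 ^ (n + r))⁻¹)} with hS
  have hvS : volume S = ENNReal.ofReal ((1 / 2) ^ (2 * (n + r))) := by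
    rw [hS, EuclideanSpace.volume_setOf_forall_mem]
    simp only [Real.volume_Ioo, add_sub_cancel_left, Finset.prod_const, Finset.card_univ,
      Fintype.card_fin]
    rw [← ENNReal.ofReal_pow (by positivity), ← inv_pow, ← pow_mul, mul_comm 2, one_div]
  have hSz : ∀ z ∈ S, ∀ k, (dyadicFloor n (x k) : ℝ) < 2 ^ n * z k ∧
      2 ^ n * z k < dyadicFloor n (x k) + (2 ^ r)⁻¹ := by
    intro z hz k
    have := hz k
    rw [Set.mem_Ioo, div_lt_iff₀ hpn, mul_comm (z k)] at this
    refine ⟨this.1, ?_⟩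
    have h := mul_lt_mul_of_pos_left this.2 hpn
    rwa [mul_add, mul_div_cancel₀ _ hpn.ne', pow_add, mul_inv, mul_inv_cancel_left₀ hpn.ne'] at h
  have hinv : ((2 : ℝ) ^ r)⁻¹ ≤ 1 := inv_le_one_of_one_le₀ (one_le_pow₀ one_le_two)
  have hfl : ∀ z ∈ S, ∀ k, dyadicFloor n (z k) = dyadicFloor n (x k) := fun z hz k =>
    dyadicFloor_eq_iff.2 ⟨(hSz z hz k).1.le, (hSz z hz k).2.trans_le (by linarith)⟩
  have hfr : ∀ z ∈ S, ∀ k, Int.fract ((2 : ℝ) ^ n * z k) < (2 ^ r)⁻¹ := by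
    intro z hz k
    have h := (hSz z hz k).2
    rw [← hfl z hz k, dyadicFloor] at h
    rw [Int.fract]
    linarith
  have hfl' : ∀ z ∈ S, ∀ k, ∀ m ≤ r, dyadicFloor (n + m) (z k) = 2 ^ m * dyadicFloor n (x k) := by
    intro z hz k m hm
    rw [← hfl z hz k, ← fract_lt_iff_dyadicFloor_add]
    exact (hfr z hz k).trans_le (inv_anti₀ (by positivity) (pow_le_pow_right₀ one_le_two hm))
  have hsub : S ⊆ dyadicFract n ⁻¹' cornerSet r ∩ dyadicCell ![n + i, n + (r - i)] x := by
    intro z hz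
    refine ⟨fun k => ⟨Int.fract_nonneg _, hfr z hz k⟩, fun k => ?_, ?_⟩
    · have h0 : (0 : ℝ) ≤ dyadicFloor n (x k) := by
        exact_mod_cast dyadicFloor_nonneg (hx k).1.le
      have h1 : (dyadicFloor n (x k) : ℝ) + 1 ≤ 2 ^ n := by
        exact_mod_cast dyadicFloor_lt (n := n) (hx k).2
      have := hSz z hz k
      constructor <;> nlinarith
    · rw [Set.mem_ofPred_eq, Fin.forall_fin_two]
      exact ⟨(hfl' z hz 0 i hi.le).trans h₁.symm, (hfl' z hz 1 (r - i) (Nat.sub_le r i)).trans h₂.symm⟩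
  refine le_trans ?_ (measure_mono hsub)
  refine (mul_le_mul_left volume_dyadicCell_le _).trans (le_of_eq ?_)
  rw [hvS, Fin.prod_univ_two, ← ENNReal.ofReal_mul (by positivity),
    ← ENNReal.ofReal_mul (by positivity)]
  congr 1
  simp only [Matrix.cons_val_zero, Matrix.cons_val_one, ← inv_pow, ← pow_add, one_div]
  congr 1
  omega

/-- The superposition of the spikes of height `c j * 2 ^ r j` over all the corner squares
of scale `n j`. -/
noncomputable def spikeSum (n r : ℕ → ℕ) (c : ℕ → ℝ) (x : EuclideanSpace ℝ (Fin 2)) : ENNReal :=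
  ∑' j, (dyadicFract (n j) ⁻¹' cornerSet (r j)).indicator
    (fun _ => ENNReal.ofReal (c j * 2 ^ r j)) x

section SpikeSum

variable {n r : ℕ → ℕ} {c : ℕ → ℝ}

lemma measurable_spikeSum : Measurable (spikeSum n r c) :=
  Measurable.tsum fun _ => measurable_const.indicator
    ((measurableSet_cornerSet _).preimage (measurable_dyadicFract _))

/-- Layer `j` has mass c·2^r·4^(-r) = c·2^(-r). Passing to the half-open cube, a dyadic set, makes
the independence formula applicable. -/
lemma lintegral_spikeSum_ne_top (hc : ∀ j, 0 ≤ c j)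
    (hsum : Summable fun j => c j * (1 / 2) ^ r j) :
    ∫⁻ x in unitCube 2, spikeSum n r c x ≠ ⊤ := by
  refine ne_top_of_le_ne_top hsum.tsum_ofReal_ne_top ?_
  refine (lintegral_mono_set unitCube_subset_halfOpenCube).trans (le_of_eq ?_)
  have hmeas : ∀ j, MeasurableSet (dyadicFract (n j) ⁻¹' cornerSet (r j)) := fun j =>
    (measurableSet_cornerSet _).preimage (measurable_dyadicFract _)
  unfold spikeSum
  rw [lintegral_tsum fun j => (measurable_const.indicator (hmeas j)).aemeasurable]
  refine tsum_congr fun j => ?_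
  rw [lintegral_indicator_const (hmeas j), Measure.restrict_apply (hmeas j), Set.inter_comm,
    (isDyadicSet_halfOpenCube (n j)).volume_inter_preimage_dyadicFract (measurableSet_cornerSet _)
      (cornerSet_subset_halfOpenCube _), volume_halfOpenCube, one_mul, volume_cornerSet,
    ← ENNReal.ofReal_mul (mul_nonneg (hc j) (by positivity))]
  congr 1
  rw [two_mul, pow_add, mul_assoc, ← mul_assoc (2 ^ r j : ℝ), ← mul_pow]
  norm_num

/-- Layer `j` alone suffices: its height c·2^r cancels the proportion 2^(-r) of the rectangle that
it occupies at least. -/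
lemma exists_le_setLIntegral_spikeSum (hc : ∀ j, 0 ≤ c j) {x : EuclideanSpace ℝ (Fin 2)}
    (hx : x ∈ unitCube 2) {j : ℕ} (hz : dyadicFract (n j) x ∈ leadingZeroSet (r j)) :
    ∃ i < r j, ENNReal.ofReal (c j) * volume (dyadicCell ![n j + i, n j + (r j - i)] x) ≤
      ∫⁻ z in dyadicCell ![n j + i, n j + (r j - i)] x, spikeSum n r c z := by
  obtain ⟨i, hi, hle⟩ := exists_volume_dyadicCell_mul_le hx hz
  refine ⟨i, hi, ?_⟩
  set B := dyadicCell ![n j + i, n j + (r j - i)] x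
  have hmeas : MeasurableSet (dyadicFract (n j) ⁻¹' cornerSet (r j)) :=
    (measurableSet_cornerSet _).preimage (measurable_dyadicFract _)
  calc ENNReal.ofReal (c j) * volume B
      = ENNReal.ofReal (c j * 2 ^ r j) * (volume B * ENNReal.ofReal ((1 / 2) ^ r j)) := by
        rw [mul_comm (volume B), ← mul_assoc,
          ← ENNReal.ofReal_mul (mul_nonneg (hc j) (by positivity)), mul_assoc, ← mul_pow]
        norm_num
    _ ≤ ENNReal.ofReal (c j * 2 ^ r j) * volume (dyadicFract (n j) ⁻¹' cornerSet (r j) ∩ B) :=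
        mul_le_mul_right hle _
    _ = ∫⁻ z in B, (dyadicFract (n j) ⁻¹' cornerSet (r j)).indicator
          (fun _ => ENNReal.ofReal (c j * 2 ^ r j)) z := by
        rw [lintegral_indicator_const hmeas, Measure.restrict_apply hmeas]
    _ ≤ ∫⁻ z in B, spikeSum n r c z := lintegral_mono fun z => ENNReal.le_tsum
          (f := fun j => (dyadicFract (n j) ⁻¹' cornerSet (r j)).indicator
            (fun _ => ENNReal.ofReal (c j * 2 ^ r j)) z) j

lemma exists_le_average_spikeSum (hc : ∀ j, 0 ≤ c j) (hsum : Summable fun j => c j * (1 / 2) ^ r j)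
    {x : EuclideanSpace ℝ (Fin 2)}
    (hx : x ∈ unitCube 2) {j : ℕ} (hz : dyadicFract (n j) x ∈ leadingZeroSet (r j)) :
    ∃ i < r j, c j ≤ (∫ z in dyadicCell ![n j + i, n j + (r j - i)] x, (spikeSum n r c z).toReal) /
      volume.real (dyadicCell ![n j + i, n j + (r j - i)] x) := by
  obtain ⟨i, hi, hle⟩ := exists_le_setLIntegral_spikeSum hc hx hz
  refine ⟨i, hi, ?_⟩
  set B := dyadicCell ![n j + i, n j + (r j - i)] x with hB
  have hBfin : volume B ≠ ⊤ :=
    ne_top_of_le_ne_top (by simp [volume_unitCube]) (measure_mono (Set.inter_subset_left))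
  have hfin : ∫⁻ z in B, spikeSum n r c z ≠ ⊤ :=
    ne_top_of_le_ne_top (lintegral_spikeSum_ne_top hc hsum) (lintegral_mono_set Set.inter_subset_left)
  have hpos : 0 < volume.real B := ENNReal.toReal_pos (volume_dyadicCell_pos hx).ne' hBfin
  -- `toReal` sends the value `⊤` to 0, which is harmless since `spikeSum` is finite almost
  -- everywhere on `B`.
  rw [le_div_iff₀ hpos, integral_toReal measurable_spikeSum.aemeasurable
    (ae_lt_top measurable_spikeSum hfin)]
  have := ENNReal.toReal_mono hfin hle
  rwa [ENNReal.toReal_mul, ENNReal.toReal_ofReal (hc j)] at this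

end SpikeSum

/-- For each `s` take 2^(2^s-s) blocks of length r = 2^s with c = s. Since 2^(2^s-s)·2^(-2^s) =
2^(-s), group `s` contributes s·2^(-s) to the first series and 1/2 to the second. -/
lemma exists_block_lengths : ∃ (r : ℕ → ℕ) (c : ℕ → ℝ), (∀ j, 0 < r j) ∧ (∀ j, 0 ≤ c j) ∧
    Tendsto c atTop atTop ∧ (Summable fun j => c j * (1 / 2) ^ r j) ∧
    ¬ Summable fun j => (r j : ℝ) * (1 / 2) ^ (r j + 1) := by
  have hle : ∀ s : ℕ, s ≤ 2 ^ s := fun s => Nat.lt_two_pow_self.le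
  have hN : ∀ s : ℕ, ((2 ^ (2 ^ s - s) : ℕ) : ℝ) * (1 / 2) ^ 2 ^ s = (1 / 2) ^ s := by
    intro s
    have : (1 / 2 : ℝ) ^ 2 ^ s = (1 / 2) ^ (2 ^ s - s) * (1 / 2) ^ s := by
      rw [← pow_add, Nat.sub_add_cancel (hle s)]
    rw [this, ← mul_assoc]
    push_cast
    rw [← mul_pow]
    norm_num
  have : Infinite (Σ s : ℕ, Fin (2 ^ (2 ^ s - s))) :=
    Infinite.of_injective (fun s => ⟨s, ⟨0, by positivity⟩⟩) fun s t h => congrArg Sigma.fst h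
  obtain ⟨e⟩ : Nonempty (ℕ ≃ Σ s : ℕ, Fin (2 ^ (2 ^ s - s))) := nonempty_equiv_of_countable
  refine ⟨fun j => 2 ^ (e j).1, fun j => (e j).1, fun j => by positivity,
    fun j => Nat.cast_nonneg _, ?_, ?_, ?_⟩
  · refine tendsto_natCast_atTop_atTop.comp ?_
    have hfst : Tendsto (Sigma.fst : (Σ s : ℕ, Fin (2 ^ (2 ^ s - s))) → ℕ) cofinite cofinite := by
      refine Tendsto.cofinite_of_finite_preimage_singleton fun s => ?_
      refine (Set.finite_range fun t : Fin (2 ^ (2 ^ s - s)) =>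
        (⟨s, t⟩ : Σ s : ℕ, Fin (2 ^ (2 ^ s - s)))).subset ?_
      rintro ⟨s', t⟩ rfl
      exact ⟨t, rfl⟩
    rw [← Nat.cofinite_eq_atTop]
    exact hfst.comp e.injective.tendsto_cofinite
  · refine (e.summable_iff (f := fun p : Σ s : ℕ, Fin (2 ^ (2 ^ s - s)) =>
      (p.1 : ℝ) * (1 / 2) ^ 2 ^ p.1)).2 ?_
    rw [summable_sigma_of_nonneg fun p => by positivity]
    refine ⟨fun s => (hasSum_fintype _).summable, ?_⟩
    simp only [tsum_fintype, Finset.sum_const, Finset.card_univ, Fintype.card_fin, nsmul_eq_mul]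
    have : ∀ s : ℕ, ((2 ^ (2 ^ s - s) : ℕ) : ℝ) * ((s : ℝ) * (1 / 2) ^ 2 ^ s) =
        (s : ℝ) ^ 1 * (1 / 2) ^ s := by
      intro s
      rw [mul_left_comm, hN, pow_one]
    simp only [this]
    exact summable_pow_mul_geometric_of_norm_lt_one 1 (by norm_num)
  · intro h
    have h := (e.summable_iff (f := fun p : Σ s : ℕ, Fin (2 ^ (2 ^ s - s)) =>
      ((2 ^ p.1 : ℕ) : ℝ) * (1 / 2) ^ (2 ^ p.1 + 1))).1 h
    rw [summable_sigma_of_nonneg fun p => by positivity] at h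
    have h := h.2
    simp only [tsum_fintype, Finset.sum_const, Finset.card_univ, Fintype.card_fin,
      nsmul_eq_mul] at h
    have this : ∀ s : ℕ, ((2 ^ (2 ^ s - s) : ℕ) : ℝ) *
        (((2 ^ s : ℕ) : ℝ) * (1 / 2) ^ (2 ^ s + 1)) = 1 / 2 := by
      intro s
      rw [pow_succ, mul_left_comm, ← mul_assoc ((2 ^ (2 ^ s - s) : ℕ) : ℝ), hN]
      push_cast
      rw [← mul_assoc, ← mul_pow]
      norm_num
    simp only [this, summable_const_iff] at h
    norm_num at h

/-- Strong differentiation fails for integrable functions, along a sequence of dyadic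
product grids. -/
lemma exists_integrableOn_not_tendsto_average :
    ∃ (ℓ : ℕ → Fin 2 → ℕ) (h : EuclideanSpace ℝ (Fin 2) → ℝ),
      (∀ m, ∀ᶠ k in atTop, ∀ i, m ≤ ℓ k i) ∧ Measurable h ∧ IntegrableOn h (unitCube 2) ∧
      ∀ᵐ x ∂volume.restrict (unitCube 2), ∀ l : ℝ, ¬ Tendsto (fun k =>
        (∫ z in dyadicCell (ℓ k) x, h z) / volume.real (dyadicCell (ℓ k) x)) atTop (𝓝 l) := by
  obtain ⟨r, c, hr, hc, hclim, hsum, hnsum⟩ := exists_block_lengths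
  set n : ℕ → ℕ := fun j => ∑ i ∈ Finset.range j, r i with hn
  have hnsucc : ∀ j, n (j + 1) = n j + r j := fun j => Finset.sum_range_succ _ _
  have hnmono : StrictMono n := strictMono_nat_of_lt_succ fun j => by
    have := hr j
    have := hnsucc j
    omega
  have : Infinite (Σ j : ℕ, Fin (r j)) :=
    Infinite.of_injective (fun j => ⟨j, ⟨0, hr j⟩⟩) fun s t h => congrArg Sigma.fst h
  -- All shapes `(j, i)` are listed in one sequence. Only finitely many share the same `j`, so `j →
  -- ∞` along any enumeration.
  obtain ⟨e⟩ : Nonempty (ℕ ≃ Σ j : ℕ, Fin (r j)) := nonempty_equiv_of_countable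
  have hfst : Tendsto (fun k => (e k).1) atTop atTop := by
    have hfst : Tendsto (Sigma.fst : (Σ j : ℕ, Fin (r j)) → ℕ) cofinite cofinite := by
      refine Tendsto.cofinite_of_finite_preimage_singleton fun j => ?_
      refine (Set.finite_range fun t : Fin (r j) => (⟨j, t⟩ : Σ j : ℕ, Fin (r j))).subset ?_
      rintro ⟨j', t⟩ rfl
      exact ⟨t, rfl⟩
    rw [← Nat.cofinite_eq_atTop]
    exact hfst.comp e.injective.tendsto_cofinite
  set ℓ : (Σ j : ℕ, Fin (r j)) → Fin 2 → ℕ := fun p => ![n p.1 + p.2, n p.1 + (r p.1 - p.2)] with hℓ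
  refine ⟨fun k => ℓ (e k), fun x => (spikeSum n r c x).toReal, fun m => ?_,
    measurable_spikeSum.ennreal_toReal, integrable_toReal_of_lintegral_ne_top
      measurable_spikeSum.aemeasurable (lintegral_spikeSum_ne_top hc hsum), ?_⟩
  · filter_upwards [(hnmono.tendsto_atTop.comp hfst).eventually_ge_atTop m] with k hk
    rw [Fin.forall_fin_two]
    exact ⟨hk.trans (Nat.le_add_right _ _), hk.trans (Nat.le_add_right _ _)⟩
  · filter_upwards [ae_frequently_mem_leadingZeroSet hnsucc hnsum,
      ae_restrict_mem (measurableSet_unitCube 2)] with x hfreq hx l hl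
    -- Convergence to `l` would keep the averages below `l + 1` from index `K` on. A covering block
    -- `j` with `c j ≥ l + 1` whose shapes all come after `K` contradicts this.
    obtain ⟨K, hK⟩ := eventually_atTop.1 (hl.eventually (gt_mem_nhds (lt_add_one l)))
    have hfin : {j | ∃ k < K, (e k).1 = j}.Finite :=
      ((Set.finite_lt_nat K).image fun k => (e k).1).subset
        fun j ⟨k, hk, hj⟩ => ⟨k, hk, hj⟩
    have hev : ∀ᶠ j in atTop, j ∉ {j | ∃ k < K, (e k).1 = j} := by
      rw [← Nat.cofinite_eq_atTop]
      exact hfin.compl_mem_cofinite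
    obtain ⟨j, hz, hj, hcj⟩ := (hfreq.and_eventually (hev.and
      (hclim.eventually_ge_atTop (l + 1)))).exists
    obtain ⟨i, hi, hle⟩ := exists_le_average_spikeSum hc hsum hx hz
    have hKk : K ≤ e.symm ⟨j, ⟨i, hi⟩⟩ := by
      by_contra! hlt
      exact hj ⟨_, hlt, by simp⟩
    have hlt := hK _ hKk
    rw [Equiv.apply_symm_apply] at hlt
    exact absurd (hle.trans_lt hlt) (not_lt.2 hcj)

/-! ### Consistency of the empirical cell averages -/

section Diagonal

variable {Ω : Type*} [MeasurableSpace Ω] {P : Measure Ω}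

/-- If every row of a double sequence tends to `0` almost surely, then one can move through the
rows so slowly that the resulting diagonal sequence tends to `0` almost surely. -/
lemma exists_slow_diagonal [IsFiniteMeasure P] {f : ℕ → ℕ → Ω → ℝ}
    (hf : ∀ k N, Measurable (f k N))
    (hlim : ∀ k, ∀ᵐ ω ∂P, Tendsto (fun N => f k N ω) atTop (𝓝 0)) :
    ∃ κ M : ℕ → ℕ, Tendsto κ atTop atTop ∧ Tendsto M atTop atTop ∧ (∀ k, κ (M k) = k) ∧
      ∀ᵐ ω ∂P, Tendsto (fun N => f (κ N) N ω) atTop (𝓝 0) := by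
  have hpos : ∀ k : ℕ, (0 : ℝ) < (1 / 2) ^ k := fun k => by positivity
  -- Egorov: row `k` converges uniformly off a set of measure at most 2^(-k). These bounds are
  -- summable, so by Borel–Cantelli almost every point lies in finitely many exceptional sets.
  have hegorov : ∀ k, ∃ t, MeasurableSet t ∧ P t ≤ ENNReal.ofReal ((1 / 2) ^ k) ∧
      TendstoUniformlyOn (f k) (fun _ => 0) atTop tᶜ := fun k =>
    tendstoUniformlyOn_of_ae_tendsto' (fun N => (hf k N).stronglyMeasurable)
      stronglyMeasurable_const (hlim k) (hpos k)
  choose t _ htP htU using hegorov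
  obtain ⟨M, hMmono, hM⟩ := extraction_forall_of_eventually
    (P := fun k N₀ => ∀ N ≥ N₀, ∀ ω ∈ (t k)ᶜ, |f k N ω| < (1 / 2) ^ k) fun k => by
      have := Metric.tendstoUniformlyOn_iff.1 (htU k) _ (hpos k)
      rw [eventually_atTop] at this ⊢
      obtain ⟨N₀, hN₀⟩ := this
      refine ⟨N₀, fun N₁ hN₁ N hN ω hω => ?_⟩
      simpa [Real.dist_eq] using hN₀ N (hN₁.trans hN) ω hω
  -- Row `k` is used for `M k ≤ N < M (k + 1)`. Searching up to `N` suffices because `k ≤ M k`. For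
  -- `N < M 0` the default 0 is returned, hence the restriction in `hκspec`.
  set κ : ℕ → ℕ := fun N => Nat.findGreatest (fun k => M k ≤ N) N with hκ
  have hκM : ∀ k, κ (M k) = k := by
    intro k
    refine le_antisymm ?_ (Nat.le_findGreatest (hMmono.le_apply) le_rfl)
    exact hMmono.le_iff_le.1 (Nat.findGreatest_spec (P := fun j => M j ≤ M k) hMmono.le_apply le_rfl)
  have hκspec : ∀ N ≥ M 0, M (κ N) ≤ N := fun N hN =>
    Nat.findGreatest_spec (P := fun k => M k ≤ N) (Nat.zero_le N) hN
  have hκtop : Tendsto κ atTop atTop := by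
    refine tendsto_atTop.2 fun k => ?_
    filter_upwards [eventually_ge_atTop (M k)] with N hN
    exact Nat.le_findGreatest (hMmono.le_apply.trans hN) hN
  refine ⟨κ, M, hκtop, hMmono.tendsto_atTop, hκM, ?_⟩
  have hsum : ∑' k, P (t k) ≠ ⊤ := by
    refine ne_top_of_le_ne_top ?_ (ENNReal.tsum_le_tsum htP)
    exact Summable.tsum_ofReal_ne_top (summable_geometric_of_lt_one (by norm_num) (by norm_num))
  filter_upwards [ae_eventually_notMem hsum] with ω hω
  refine squeeze_zero_norm' (a := fun N => (1 / 2 : ℝ) ^ κ N) ?_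
    ((tendsto_pow_atTop_nhds_zero_of_lt_one (by norm_num) (by norm_num)).comp hκtop)
  filter_upwards [hκtop.eventually hω, eventually_ge_atTop (M 0)] with N hN hN0
  exact (hM (κ N) N (hκspec N hN0) ω hN).le

end Diagonal

section StrongLaw

variable {Ω : Type*} [MeasurableSpace Ω] {P : Measure Ω} {d : ℕ}
  {X : ℕ → Ω → EuclideanSpace ℝ (Fin d)} {Y : ℕ → Ω → ℝ}

/-- Division by zero yields 0, which is the convention for empty cells. -/
lemma cellEstimate_eq_div (Q : Set (Set (EuclideanSpace ℝ (Fin d)))) (N : ℕ)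
    (x : ℕ → EuclideanSpace ℝ (Fin d)) (y : ℕ → ℝ) (u : EuclideanSpace ℝ (Fin d)) :
    cellEstimate Q N x y u =
      empiricalSum N x y (cell Q u) / empiricalProb N x (cell Q u) := by
  have hnn : 0 ≤ empiricalProb N x (cell Q u) :=
    mul_nonneg (by positivity) (Finset.sum_nonneg fun n _ =>
      Set.indicator_nonneg (fun _ _ => zero_le_one) _)
  rw [cellEstimate]
  split_ifs with h
  · rfl
  · rw [le_antisymm (not_lt.1 h) hnn, div_zero]

lemma ae_tendsto_average_comp (hind : iIndepFun (fun n ω => (X n ω, Y n ω)) P)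
    (hid : ∀ n, IdentDistrib (fun ω => (X n ω, Y n ω)) (fun ω => (X 0 ω, Y 0 ω)) P P)
    {F : EuclideanSpace ℝ (Fin d) × ℝ → ℝ} (hF : Measurable F)
    (hint : Integrable (fun ω => F (X 0 ω, Y 0 ω)) P) :
    ∀ᵐ ω ∂P, Tendsto (fun N : ℕ => (1 / (N : ℝ)) * ∑ n ∈ Finset.Icc 1 N, F (X n ω, Y n ω))
      atTop (𝓝 (∫ ω, F (X 0 ω, Y 0 ω) ∂P)) := by
  have hidF : ∀ n, IdentDistrib (fun ω => F (X n ω, Y n ω)) (fun ω => F (X 0 ω, Y 0 ω)) P P :=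
    fun n => (hid n).comp hF
  -- The shift by one leaves out index 0, the test pair.
  have h := strong_law_ae_real (fun n ω => F (X (n + 1) ω, Y (n + 1) ω))
    ((hidF 1).symm.integrable_snd hint)
    (fun i j hij => (hind.indepFun (fun h => hij (Nat.succ_injective h))).comp hF hF)
    (fun i => (hidF (i + 1)).trans (hidF 1).symm)
  rw [(hidF (0 + 1)).integral_eq] at h
  filter_upwards [h] with ω hω
  refine hω.congr fun N => ?_
  rw [Finset.range_eq_Ico, Finset.sum_Ico_add' (fun n => F (X n ω, Y n ω)), zero_add,
    one_div, div_eq_inv_mul]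
  rfl

lemma measurable_empiricalRatio (hX : ∀ n, Measurable (X n)) (hY : ∀ n, Measurable (Y n))
    {B : Set (EuclideanSpace ℝ (Fin d))} (hB : MeasurableSet B) (N : ℕ) :
    Measurable fun ω => empiricalSum N (fun n => X n ω) (fun n => Y n ω) B /
      empiricalProb N (fun n => X n ω) B := by
  have hind : ∀ n, Measurable fun ω => B.indicator (1 : EuclideanSpace ℝ (Fin d) → ℝ) (X n ω) := fun n =>
    (measurable_one.indicator hB).comp (hX n)
  unfold empiricalSum empiricalProb
  fun_prop

lemma ae_tendsto_empiricalRatio [IsProbabilityMeasure P]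
    (hX : ∀ n, Measurable (X n))
    (hind : iIndepFun (fun n ω => (X n ω, Y n ω)) P)
    (hid : ∀ n, IdentDistrib (fun ω => (X n ω, Y n ω)) (fun ω => (X 0 ω, Y 0 ω)) P P)
    (hint : Integrable (Y 0) P) {B : Set (EuclideanSpace ℝ (Fin d))} (hB : MeasurableSet B)
    (hPB : P.real (X 0 ⁻¹' B) ≠ 0) :
    ∀ᵐ ω ∂P, Tendsto (fun N => empiricalSum N (fun n => X n ω) (fun n => Y n ω) B /
      empiricalProb N (fun n => X n ω) B) atTop
      (𝓝 ((∫ ω, Y 0 ω * B.indicator 1 (X 0 ω) ∂P) / P.real (X 0 ⁻¹' B))) := by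
  have hmi : Measurable (B.indicator (1 : EuclideanSpace ℝ (Fin d) → ℝ)) := measurable_one.indicator hB
  have hind0 : (fun ω => B.indicator (1 : EuclideanSpace ℝ (Fin d) → ℝ) (X 0 ω)) = (X 0 ⁻¹' B).indicator 1 :=
    rfl
  have hnum := ae_tendsto_average_comp hind hid (F := fun p => p.2 * B.indicator 1 p.1)
    (measurable_snd.mul (hmi.comp measurable_fst)) (by
      refine (hint.indicator ((hX 0) hB)).congr (Eventually.of_forall fun ω => ?_)
      by_cases h : X 0 ω ∈ B <;> simp [Set.indicator, h])
  have hden := ae_tendsto_average_comp hind hid (F := fun p => B.indicator 1 p.1)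
    (hmi.comp measurable_fst) (by
      rw [hind0]
      exact (integrable_const (1 : ℝ)).indicator ((hX 0) hB))
  rw [hind0, integral_indicator_one ((hX 0) hB)] at hden
  filter_upwards [hnum, hden] with ω h₁ h₂
  exact h₁.div h₂ hPB

end StrongLaw

/-- Along a sequence of dyadic grids that is traversed slowly enough, the tree-structured
estimate tracks the population cell averages. -/
lemma exists_slow_dyadicGrid {Ω : Type*} [MeasurableSpace Ω] {P : Measure Ω} {d : ℕ}
    [IsProbabilityMeasure P] {X : ℕ → Ω → EuclideanSpace ℝ (Fin d)} {Y : ℕ → Ω → ℝ}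
    (hX : ∀ n, Measurable (X n)) (hY : ∀ n, Measurable (Y n))
    (hind : iIndepFun (fun n ω => (X n ω, Y n ω)) P)
    (hid : ∀ n, IdentDistrib (fun ω => (X n ω, Y n ω)) (fun ω => (X 0 ω, Y 0 ω)) P P)
    (hmap : P.map (X 0) = volume.restrict (unitCube d)) (hint : Integrable (Y 0) P)
    (ℓ : ℕ → Fin d → ℕ) :
    ∃ κ M : ℕ → ℕ, Tendsto κ atTop atTop ∧ Tendsto M atTop atTop ∧ (∀ k, κ (M k) = k) ∧
      ∀ᵐ ω ∂P, Tendsto (fun N => cellEstimate (dyadicGrid (ℓ (κ N))) N (fun n => X n ω)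
        (fun n => Y n ω) (X 0 ω) - cellMean P (X 0) (Y 0) (dyadicGrid (ℓ (κ N))) (X 0 ω))
        atTop (𝓝 0) := by
  set err : Set (EuclideanSpace ℝ (Fin d)) → ℕ → Ω → ℝ := fun B N ω =>
    |empiricalSum N (fun n => X n ω) (fun n => Y n ω) B / empiricalProb N (fun n => X n ω) B -
      (∫ ω, Y 0 ω * B.indicator 1 (X 0 ω) ∂P) / P.real (X 0 ⁻¹' B)| with herr
  have hgrid : ∀ k, ∀ B ∈ dyadicGrid (ℓ k), MeasurableSet B := by
    rintro k _ ⟨x, -, rfl⟩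
    exact measurableSet_dyadicCell
  have hPB : ∀ k, ∀ B ∈ dyadicGrid (ℓ k), P.real (X 0 ⁻¹' B) ≠ 0 := by
    intro k B hB
    have hBm := hgrid k B hB
    obtain ⟨x, hx, rfl⟩ := hB
    rw [← map_measureReal_apply (hX 0) hBm, hmap, measureReal_def, ENNReal.toReal_ne_zero,
      Measure.restrict_apply hBm, show dyadicCell (ℓ k) x ∩ unitCube d = dyadicCell (ℓ k) x from
        Set.inter_eq_left.2 Set.inter_subset_left]
    exact ⟨(volume_dyadicCell_pos hx).ne', ne_top_of_le_ne_top (by simp [volume_unitCube])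
      (measure_mono Set.inter_subset_left)⟩
  -- Row `k` is the total error over all cells of the `k`-th grid; it dominates the error at the
  -- random cell of `X 0`.
  obtain ⟨κ, M, hκ, hM, hκM, hlim⟩ := exists_slow_diagonal (P := P)
    (f := fun k N ω => ∑ B ∈ (finite_dyadicGrid (ℓ := ℓ k)).toFinset, err B N ω)
    (fun k N => Finset.measurable_sum _ fun B hB =>
      ((measurable_empiricalRatio hX hY
        (hgrid k B ((Set.Finite.mem_toFinset _).1 hB)) N).sub_const _).norm) (fun k => by
      have : ∀ᵐ ω ∂P, ∀ B ∈ dyadicGrid (ℓ k), Tendsto (fun N => err B N ω) atTop (𝓝 0) := by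
        refine (ae_ball_iff finite_dyadicGrid.countable).2 fun B hB => ?_
        filter_upwards [ae_tendsto_empiricalRatio hX hind hid hint (hgrid k B hB)
          (hPB k B hB)] with ω hω
        have := (hω.sub_const
          ((∫ ω, Y 0 ω * B.indicator 1 (X 0 ω) ∂P) / P.real (X 0 ⁻¹' B))).abs
        rwa [sub_self, abs_zero] at this
      filter_upwards [this] with ω hω
      have := tendsto_finsetSum (finite_dyadicGrid (ℓ := ℓ k)).toFinset fun B hB =>
        hω B ((Set.Finite.mem_toFinset _).1 hB)
      rwa [Finset.sum_const_zero] at this)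
  refine ⟨κ, M, hκ, hM, hκM, ?_⟩
  have hcube : ∀ᵐ ω ∂P, X 0 ω ∈ unitCube d := by
    refine ae_of_ae_map (hX 0).aemeasurable ?_
    rw [hmap]
    exact ae_restrict_mem (measurableSet_unitCube d)
  filter_upwards [hlim, hcube] with ω hω hx
  refine squeeze_zero_norm (fun N => ?_) hω
  rw [cellEstimate_eq_div, cellMean, cell_dyadicGrid hx, Real.norm_eq_abs]
  exact Finset.single_le_sum (f := fun B => err B N ω) (fun B _ => abs_nonneg _)
    ((Set.Finite.mem_toFinset _).2 ⟨_, hx, rfl⟩)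
/-- The pair `(X 0, Y 0)` is the test case `(X, Y)`; the pairs `(X n, Y n)`, `n ≥ 1`, are the
learning sample. -/
theorem theorem1p2 :
    ∃ Q : ℕ → Set (Set (EuclideanSpace ℝ (Fin 2))),
      (∀ N, IsTreePartition (unitCube 2) (Q N)) ∧
      (∀ N, ∀ B ∈ Q N, 0 < volume B) ∧
      Tendsto (fun N => mesh (Q N)) atTop (𝓝 0) ∧
      ∃ (Ω : Type) (_ : MeasurableSpace Ω) (P : Measure Ω)
        (X : ℕ → Ω → EuclideanSpace ℝ (Fin 2)) (Y : ℕ → Ω → ℝ)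
        (h : EuclideanSpace ℝ (Fin 2) → ℝ),
        IsProbabilityMeasure P ∧
        (∀ n, Measurable (X n)) ∧ (∀ n, Measurable (Y n)) ∧
        iIndepFun (fun n ω => (X n ω, Y n ω)) P ∧
        (∀ n, IdentDistrib (fun ω => (X n ω, Y n ω)) (fun ω => (X 0 ω, Y 0 ω)) P P) ∧
        pdf.IsUniform (X 0) (unitCube 2) P volume ∧
        Integrable (Y 0) P ∧
        IsRegressionFunction P (X 0) (Y 0) h ∧
        (∀ᵐ ω ∂P, Tendsto
          (fun N => cellEstimate (Q N) N (fun n => X n ω) (fun n => Y n ω) (X 0 ω)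
            - cellMean P (X 0) (Y 0) (Q N) (X 0 ω)) atTop (𝓝 0)) ∧
        P {ω | Tendsto (fun N => cellMean P (X 0) (Y 0) (Q N) (X 0 ω) - h (X 0 ω))
            atTop (𝓝 0)} = 0 ∧
        P {ω | Tendsto (fun N => cellEstimate (Q N) N (fun n => X n ω) (fun n => Y n ω) (X 0 ω))
            atTop (𝓝 (h (X 0 ω)))} = 0 := by
  obtain ⟨ℓ, h, hℓ, hh, hhint, hdiv⟩ := exists_integrableOn_not_tendsto_average
  have : IsProbabilityMeasure (volume.restrict (unitCube 2)) :=
    ⟨by rw [Measure.restrict_apply_univ, volume_unitCube]⟩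
  set P : Measure (ℕ → EuclideanSpace ℝ (Fin 2)) :=
    Measure.infinitePi fun _ => volume.restrict (unitCube 2)
  set X : ℕ → (ℕ → EuclideanSpace ℝ (Fin 2)) → EuclideanSpace ℝ (Fin 2) := fun n ω => ω n
  have hX : ∀ n, Measurable (X n) := fun n => measurable_pi_apply n
  have hY : ∀ n, Measurable fun ω => h (X n ω) := fun n => hh.comp (hX n)
  have hmap : ∀ n, P.map (X n) = volume.restrict (unitCube 2) := fun n =>
    Measure.infinitePi_map_eval _ n
  have hpair : Measurable fun x : EuclideanSpace ℝ (Fin 2) => (x, h x) := measurable_id.prodMk hh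
  have hind : iIndepFun (fun n ω => (X n ω, h (X n ω))) P :=
    iIndepFun_infinitePi (X := fun _ x => (x, h x)) fun _ => hpair
  have hid : ∀ n, IdentDistrib (fun ω => (X n ω, h (X n ω))) (fun ω => (X 0 ω, h (X 0 ω))) P P :=
    fun n => IdentDistrib.comp ⟨(hX n).aemeasurable, (hX 0).aemeasurable,
      (hmap n).trans (hmap 0).symm⟩ hpair
  have hint : Integrable (fun ω => h (X 0 ω)) P := by
    refine Integrable.comp_measurable ?_ (hX 0)
    rw [hmap 0]
    exact hhint
  obtain ⟨κ, M, hκ, hM, hκM, hlim⟩ := exists_slow_dyadicGrid hX hY hind hid (hmap 0) hint ℓ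
  have hmean : ∀ k, ∀ x ∈ unitCube 2,
      cellMean P (X 0) (fun ω => h (X 0 ω)) (dyadicGrid (ℓ k)) x =
        (∫ z in dyadicCell (ℓ k) x, h z) / volume.real (dyadicCell (ℓ k) x) := by
    intro k x hx
    have hB : MeasurableSet (dyadicCell (ℓ k) x) := measurableSet_dyadicCell
    have hBs : dyadicCell (ℓ k) x ∩ unitCube 2 = dyadicCell (ℓ k) x :=
      Set.inter_eq_left.2 Set.inter_subset_left
    rw [cellMean, cell_dyadicGrid hx, ← map_measureReal_apply (hX 0) hB,
      ← integral_map (φ := X 0) (f := fun z => h z * (dyadicCell (ℓ k) x).indicator 1 z)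
        (hX 0).aemeasurable (hh.mul (measurable_one.indicator hB)).aestronglyMeasurable,
      hmap 0, measureReal_restrict_apply hB, hBs]
    congr 1
    have : (fun z => h z * (dyadicCell (ℓ k) x).indicator 1 z) =
        (dyadicCell (ℓ k) x).indicator h := by
      ext z
      by_cases hz : z ∈ dyadicCell (ℓ k) x <;> simp [hz]
    rw [this, integral_indicator hB, Measure.restrict_restrict hB, hBs]
  have hnot : ∀ᵐ ω ∂P, ∀ l : ℝ, ¬ Tendsto (fun N =>
      cellMean P (X 0) (fun ω => h (X 0 ω)) (dyadicGrid (ℓ (κ N))) (X 0 ω)) atTop (𝓝 l) := by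
    refine ae_of_ae_map (f := X 0) (hX 0).aemeasurable
      (p := fun x => ∀ l : ℝ, ¬ Tendsto (fun N =>
        cellMean P (X 0) (fun ω => h (X 0 ω)) (dyadicGrid (ℓ (κ N))) x) atTop (𝓝 l)) ?_
    rw [hmap 0]
    filter_upwards [hdiv, ae_restrict_mem (measurableSet_unitCube 2)] with x hx hxc l hl
    -- Along `N = M k` the grids run through the whole sequence `ℓ`, so a limit would be a limit of
    -- the divergent averages.
    refine hx l ((hl.comp hM).congr fun k => ?_)
    rw [Function.comp_apply, hκM, hmean k x hxc]
  refine ⟨fun N => dyadicGrid (ℓ (κ N)), fun N => isTreePartition_dyadicGrid _, ?_, ?_,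
    ℕ → EuclideanSpace ℝ (Fin 2), inferInstance, P, X, fun n ω => h (X n ω), h, inferInstance, hX,
    hY, hind, hid, ?_, hint, ⟨hh, ?_⟩, hlim, ?_, ?_⟩
  · rintro N _ ⟨x, hx, rfl⟩
    exact volume_dyadicCell_pos hx
  · have hzero : Tendsto (fun m : ℕ => ENNReal.ofReal (√(2 : ℕ) * (2 ^ m)⁻¹)) atTop (𝓝 0) := by
      have := (tendsto_inv_atTop_zero.comp
        (tendsto_pow_atTop_atTop_of_one_lt (one_lt_two (α := ℝ)))).const_mul √(2 : ℕ)
      rw [mul_zero] at this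
      simpa using ENNReal.tendsto_ofReal this
    refine ENNReal.tendsto_nhds_zero.2 fun ε hε => ?_
    obtain ⟨m, hm⟩ := (ENNReal.tendsto_nhds_zero.1 hzero ε hε).exists
    filter_upwards [hκ.eventually (hℓ m)] with N hN
    exact (mesh_dyadicGrid_le hN).trans hm
  · rw [pdf.IsUniform, hmap 0, ProbabilityTheory.cond, volume_unitCube, inv_one, one_smul]
  · have hsm : StronglyMeasurable[MeasurableSpace.comap (X 0) inferInstance]
        fun ω => h (X 0 ω) :=
      (hh.comp (comap_measurable (X 0))).stronglyMeasurable
    rw [condExp_of_stronglyMeasurable (hX 0).comap_le hsm hint]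
  · refine measure_eq_zero_iff_ae_notMem.2 ?_
    filter_upwards [hnot] with ω hω hl
    refine hω (h (X 0 ω)) ?_
    simpa using Tendsto.add_const (h (X 0 ω)) hl
  · refine measure_eq_zero_iff_ae_notMem.2 ?_
    -- Subtracting the vanishing difference would make the population averages converge.
    filter_upwards [hnot, hlim] with ω hω hlimω hl
    refine hω (h (X 0 ω)) ?_
    simpa using Tendsto.sub hl hlimω
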